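/- Let $\mathbb D=\{z\in\mathbb C: |z|<1\}$ and let $f\colon\overline{\mathbb D}\to\overline{\mathbb D}$ be a homeomorphism of the closed unit disk onto itself which is harmonic in $\mathbb D$ (that is, $f$ is $C^2$ in $\mathbb D$ and $\Delta f=0$ there) and which is $C^1$-smooth (in the real sense) in $\overline{\mathbb D}$. Denote by $Df(z)$ the real differential of $f$ at $z$ (at boundary points, the derivative taken within $\overline{\mathbb D}$) and by $|Df|^2=|f_x|^2+|f_y|^2$ the square of its Hilbert–Schmidt norm. Then $$\int_{\partial\mathbb D}|\det Df|\,|dz|\;\ge\;\iint_{\mathbb D}|Df|^2\;\ge\;2\iint_{\mathbb D}|\det Df|\;=\;2\pi ,$$ where $|dz|$ is arc length and the double integrals are taken with respect to area. The first inequality is strict unless $f$ is an isometry, i.e. unless $|f(z)-f(w)|=|z-w|$ for all $z,w\in\overline{\mathbb D}$; if $f$ is an isometry, it is an equality. -/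

import Mathlib

/-- The closed unit disk in the complex plane. -/
def closedUnitDisk : Set ℂ := Metric.closedBall (0 : ℂ) 1

/-- The open unit disk in the complex plane. -/
def openUnitDisk : Set ℂ := Metric.ball (0 : ℂ) 1

/-- `f` restricts to a homeomorphism of `S` onto `T` (subspace topologies):
it is a continuous bijection from `S` onto `T` whose inverse is continuous on `T`. -/
def IsHomeomorphOnto (f : ℂ → ℂ) (S T : Set ℂ) : Prop :=
  Set.BijOn f S T ∧ ContinuousOn f S ∧ ContinuousOn (Function.invFunOn f S) T

/-- The real differential `Df(z) : ℂ → ℂ` of a map defined on the closed unit disk. At interior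
points it is the usual Fréchet derivative; at boundary points it is the derivative taken within
the closed disk. Only the values of `f` on the closed disk matter. -/
noncomputable def diskDeriv (f : ℂ → ℂ) (z : ℂ) : ℂ →L[ℝ] ℂ :=
  fderivWithin ℝ f closedUnitDisk z

/-- The squared Hilbert-Schmidt norm `|A|² = |A 1|² + |A i|²` of a real-linear map of the plane,
so that `|Df|² = |f_x|² + |f_y|²`. -/
noncomputable def hsNormSq (A : ℂ →L[ℝ] ℂ) : ℝ :=
  ‖A 1‖ ^ 2 + ‖A Complex.I‖ ^ 2

/-- The integral of `|det Df|` over the unit circle with respect to arc length. -/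
noncomputable def boundaryJacobian (f : ℂ → ℂ) : ℝ :=
  ∫ θ in (0 : ℝ)..2 * Real.pi, |(diskDeriv f (circleMap 0 1 θ)).det|

/-- The Dirichlet energy of `f`: the integral of `|Df|²` over the unit disk. -/
noncomputable def diskEnergy (f : ℂ → ℂ) : ℝ :=
  ∫ z in openUnitDisk, hsNormSq (diskDeriv f z)

/-- The integral of `|det Df|` over the unit disk. -/
noncomputable def diskJacobian (f : ℂ → ℂ) : ℝ :=
  ∫ z in openUnitDisk, |(diskDeriv f z).det|

/-- The antiderivative of `sin ^ 2` vanishing at `0`. -/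
noncomputable def sinSqPrimitive (x : ℝ) : ℝ := (x - Real.sin x * Real.cos x) / 2

theorem hasDerivAt_sinSqPrimitive (x : ℝ) :
    HasDerivAt sinSqPrimitive (Real.sin x ^ 2) x := by
  have h := ((hasDerivAt_id x).sub ((Real.hasDerivAt_sin x).mul (Real.hasDerivAt_cos x))).div_const 2
  refine HasDerivAt.congr_deriv (f := sinSqPrimitive) h ?_
  linear_combination (-1 / 2 : ℝ) * Real.sin_sq_add_cos_sq x

theorem sinSqPrimitive_pi_sub (x : ℝ) :
    sinSqPrimitive (Real.pi - x) = Real.pi / 2 - sinSqPrimitive x := by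
  simp only [sinSqPrimitive, Real.sin_pi_sub, Real.cos_pi_sub]; ring

open Filter Topology Asymptotics in
theorem sinSqPrimitive_isLittleO : sinSqPrimitive =o[𝓝 0] fun x : ℝ => x ^ 2 := by
  have hO : sinSqPrimitive =O[𝓝 0] fun x : ℝ => x ^ 3 := by
    refine IsBigO.of_bound 1 ?_
    have : ∀ᶠ x : ℝ in 𝓝 0, |x| < 1 / 2 := by
      have := Metric.ball_mem_nhds (0 : ℝ) (show (0 : ℝ) < 1 / 2 by norm_num)
      filter_upwards [this] with x hx
      simpa [Real.dist_eq] using hx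
    filter_upwards [this] with x hx
    have h1 := Real.sin_bound (x := 2 * x) (by rw [abs_mul, abs_two]; linarith)
    rw [Real.sin_two_mul] at h1
    have e1 : |2 * x| ^ 5 = 32 * |x| ^ 3 * |x| ^ 2 := by rw [abs_mul, abs_two]; ring
    rw [e1] at h1
    rw [Real.norm_eq_abs, Real.norm_eq_abs, abs_pow, one_mul]
    have h2 : sinSqPrimitive x = -(2 * Real.sin x * Real.cos x - (2 * x - (2 * x) ^ 3 / 6)) / 4
        + x ^ 3 / 3 := by unfold sinSqPrimitive; ring
    rw [h2]
    have h3 : |x ^ 3| = |x| ^ 3 := abs_pow x 3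
    have h4 : (0 : ℝ) ≤ |x| ^ 3 := by positivity
    have h5 : |x| ^ 3 * |x| ^ 2 ≤ |x| ^ 3 * (1 / 2) ^ 2 := by gcongr
    refine (abs_add_le _ _).trans ?_
    rw [abs_div, abs_neg, abs_div, h3]
    norm_num
    linarith
  exact hO.trans_isLittleO (isLittleO_pow_pow (by norm_num))

open Filter Topology Asymptotics in
theorem tendsto_sinSqPrimitive_quotient {b : ℝ → ℝ} {c : ℝ} (hb : HasDerivAt b c 0)
    (h0 : b 0 = 0) :
    Tendsto (fun a => (sinSqPrimitive (b a) - sinSqPrimitive a) / Real.sin a ^ 2) (𝓝 0) (𝓝 0) := by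
  apply IsLittleO.tendsto_div_nhds_zero
  have hs : (fun a : ℝ => a) =O[𝓝 0] Real.sin := by
    have := ((Real.hasDerivAt_sin 0).isTheta_sub (by simp)).2
    simpa [Function.comp_def] using this
  have hbO : b =O[𝓝 0] fun a : ℝ => a := by simpa [h0] using hb.isBigO_sub
  have hbt : Tendsto b (𝓝 0) (𝓝 0) := by simpa [ContinuousAt, h0] using hb.continuousAt
  have e1 := ((sinSqPrimitive_isLittleO.comp_tendsto hbt).trans_isBigO (hbO.pow 2)).trans_isBigO
    (hs.pow 2)
  exact e1.sub (sinSqPrimitive_isLittleO.trans_isBigO (hs.pow 2))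

/-- The nonnegative function governing the convexity inequality `arc_integral_nonneg`. -/
noncomputable def arcDefect (a x : ℝ) : ℝ :=
  2 * (sinSqPrimitive x - sinSqPrimitive a) * Real.cos a
    + (Real.sin a ^ 2 - Real.sin x ^ 2) * Real.sin a

theorem hasDerivAt_arcDefect (a x : ℝ) :
    HasDerivAt (arcDefect a) (2 * Real.sin x * Real.sin (x - a)) x := by
  have h := (((((hasDerivAt_sinSqPrimitive x).sub_const (sinSqPrimitive a)).const_mul 2).mul_const
    (Real.cos a)).add ((((Real.hasDerivAt_sin x).pow 2).const_sub (Real.sin a ^ 2)).mul_const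
    (Real.sin a)))
  refine HasDerivAt.congr_deriv (f := arcDefect a) h ?_
  rw [Real.sin_sub]; push_cast; ring

theorem arcDefect_self (a : ℝ) : arcDefect a a = 0 := by simp [arcDefect]

theorem arcDefect_pos {a x : ℝ} (ha : a ∈ Set.Ioo 0 Real.pi) (hx : x ∈ Set.Icc 0 Real.pi)
    (hne : x ≠ a) : 0 < arcDefect a x := by
  have hc : Continuous (arcDefect a) :=
    continuous_iff_continuousAt.2 fun x => (hasDerivAt_arcDefect a x).continuousAt
  rw [← arcDefect_self a]
  rcases lt_or_gt_of_ne hne with h | h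
  · have : StrictAntiOn (arcDefect a) (Set.Icc 0 a) := by
      apply strictAntiOn_of_deriv_neg (convex_Icc _ _) hc.continuousOn
      intro y hy
      rw [interior_Icc] at hy
      rw [(hasDerivAt_arcDefect a y).deriv]
      have h1 : 0 < Real.sin y := Real.sin_pos_of_pos_of_lt_pi hy.1 (hy.2.trans ha.2)
      have h2 : Real.sin (y - a) < 0 :=
        Real.sin_neg_of_neg_of_neg_pi_lt (by linarith [hy.2]) (by linarith [hy.1, ha.2])
      nlinarith
    exact this ⟨hx.1, h.le⟩ ⟨ha.1.le, le_rfl⟩ h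
  · have : StrictMonoOn (arcDefect a) (Set.Icc a Real.pi) := by
      apply strictMonoOn_of_deriv_pos (convex_Icc _ _) hc.continuousOn
      intro y hy
      rw [interior_Icc] at hy
      rw [(hasDerivAt_arcDefect a y).deriv]
      have h1 : 0 < Real.sin y := Real.sin_pos_of_pos_of_lt_pi (ha.1.trans hy.1) hy.2
      have h2 : 0 < Real.sin (y - a) :=
        Real.sin_pos_of_pos_of_lt_pi (by linarith [hy.1]) (by linarith [hy.2, ha.1])
      positivity
    exact this ⟨le_rfl, ha.2.le⟩ ⟨h.le, hx.2⟩ h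

open Filter Topology MeasureTheory in
theorem arc_integral_nonneg {b b' : ℝ → ℝ} (hb : ∀ a, HasDerivAt b (b' a) a)
    (hb' : Continuous b') (hpos : ∀ a, 0 ≤ b' a) (h0 : b 0 = 0) (hpi : b Real.pi = Real.pi)
    (hint : IntervalIntegrable (fun a => (b' a - 1) * (Real.sin (b a) ^ 2 / Real.sin a ^ 2))
      volume 0 Real.pi) :
    0 ≤ ∫ a in (0 : ℝ)..Real.pi, (b' a - 1) * (Real.sin (b a) ^ 2 / Real.sin a ^ 2) ∧
    ((∫ a in (0 : ℝ)..Real.pi, (b' a - 1) * (Real.sin (b a) ^ 2 / Real.sin a ^ 2)) = 0 →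
      ∀ a ∈ Set.Icc 0 Real.pi, b a = a) := by
  set φ : ℝ → ℝ := fun a => (b' a - 1) * (Real.sin (b a) ^ 2 / Real.sin a ^ 2) with hφ
  set W : ℝ → ℝ := fun a => (sinSqPrimitive (b a) - sinSqPrimitive a) / Real.sin a ^ 2 with hW
  have hbc : Continuous b := continuous_iff_continuousAt.2 fun x => (hb x).continuousAt
  have hmono : Monotone b := monotone_of_hasDerivAt_nonneg hb hpos
  have hbmem : ∀ a ∈ Set.Icc 0 Real.pi, b a ∈ Set.Icc 0 Real.pi := fun a ha =>
    ⟨h0 ▸ hmono ha.1, hpi ▸ hmono ha.2⟩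
  have hW0 : W 0 = 0 := by simp [hW]
  have hWpi : W Real.pi = 0 := by simp [hW]
  have hWd : ∀ a ∈ Set.Ioo 0 Real.pi,
      HasDerivAt W (φ a - arcDefect a (b a) / Real.sin a ^ 3) a := by
    intro a ha
    have hs : Real.sin a ≠ 0 := (Real.sin_pos_of_pos_of_lt_pi ha.1 ha.2).ne'
    have h := (((hasDerivAt_sinSqPrimitive (b a)).comp a (hb a)).sub
      (hasDerivAt_sinSqPrimitive a)).div ((Real.hasDerivAt_sin a).pow 2) (pow_ne_zero 2 hs)
    refine HasDerivAt.congr_deriv (f := W) h ?_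
    simp only [hφ, arcDefect, Pi.sub_apply, Function.comp_apply, Pi.pow_apply]
    field_simp
    push_cast
    ring
  have hWc : ContinuousOn W (Set.Icc 0 Real.pi) := by
    intro a ha
    apply ContinuousAt.continuousWithinAt
    rcases eq_or_lt_of_le ha.1 with h | h
    · rw [← h, ContinuousAt, hW0]
      exact tendsto_sinSqPrimitive_quotient (hb 0) h0
    rcases eq_or_lt_of_le ha.2 with h' | h'
    · rw [h', ContinuousAt, hWpi]
      have hd : HasDerivAt (fun x => Real.pi - b (Real.pi - x)) (b' Real.pi) 0 := by
        have h1 : HasDerivAt b (b' Real.pi) (Real.pi - 0) := by simpa using hb Real.pi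
        have := (h1.comp (0 : ℝ) ((hasDerivAt_id (0 : ℝ)).const_sub Real.pi)).const_sub Real.pi
        exact this.congr_deriv (by ring)
      have ht := tendsto_sinSqPrimitive_quotient hd (by simp [hpi])
      have h2 : Tendsto (fun x : ℝ => Real.pi - x) (𝓝 Real.pi) (𝓝 0) := by
        have : Continuous fun x : ℝ => Real.pi - x := by fun_prop
        simpa using this.tendsto Real.pi
      have h3 := (ht.comp h2).neg
      rw [neg_zero] at h3
      refine h3.congr fun x => ?_
      simp only [hW, Function.comp_apply, sub_sub_cancel, sinSqPrimitive_pi_sub, Real.sin_pi_sub]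
      ring
    · exact (hWd a ⟨h, h'⟩).continuousAt
  have hG : ∀ a ∈ Set.Ioo 0 Real.pi, 0 ≤ arcDefect a (b a) / Real.sin a ^ 3 := by
    intro a ha
    have hs := Real.sin_pos_of_pos_of_lt_pi ha.1 ha.2
    refine div_nonneg ?_ (pow_pos hs 3).le
    by_cases h : b a = a
    · rw [h, arcDefect_self]
    · exact (arcDefect_pos ha (hbmem a ⟨ha.1.le, ha.2.le⟩) h).le
  have hon : IntegrableOn φ (Set.Icc 0 Real.pi) := by
    rw [integrableOn_Icc_iff_integrableOn_Ioc]
    exact (intervalIntegrable_iff_integrableOn_Ioc_of_le Real.pi_pos.le).1 hint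
  have key : ∀ x ∈ Set.Icc 0 Real.pi, ∀ y ∈ Set.Icc 0 Real.pi, x ≤ y →
      W y - W x ≤ ∫ a in x..y, φ a := by
    intro x hx y hy hxy
    refine intervalIntegral.sub_le_integral_of_hasDeriv_right_of_le
      (g' := fun a => φ a - arcDefect a (b a) / Real.sin a ^ 3) hxy
      (hWc.mono (Set.Icc_subset_Icc hx.1 hy.2)) ?_ (hon.mono_set (Set.Icc_subset_Icc hx.1 hy.2)) ?_
    · intro a ha
      exact (hWd a ⟨hx.1.trans_lt ha.1, ha.2.trans_le hy.2⟩).hasDerivWithinAt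
    · intro a ha
      have := hG a ⟨hx.1.trans_lt ha.1, ha.2.trans_le hy.2⟩
      linarith
  have m0 : (0 : ℝ) ∈ Set.Icc 0 Real.pi := ⟨le_rfl, Real.pi_pos.le⟩
  have mpi : Real.pi ∈ Set.Icc 0 Real.pi := ⟨Real.pi_pos.le, le_rfl⟩
  refine ⟨by simpa [hW0, hWpi] using key 0 m0 _ mpi Real.pi_pos.le, fun hzero => ?_⟩
  have hii : ∀ x ∈ Set.Icc 0 Real.pi, IntervalIntegrable φ volume 0 x ∧
      IntervalIntegrable φ volume x Real.pi := by
    intro x hx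
    refine ⟨hint.mono_set ?_, hint.mono_set ?_⟩
    · rw [Set.uIcc_of_le hx.1, Set.uIcc_of_le Real.pi_pos.le]
      exact Set.Icc_subset_Icc le_rfl hx.2
    · rw [Set.uIcc_of_le hx.2, Set.uIcc_of_le Real.pi_pos.le]
      exact Set.Icc_subset_Icc hx.1 le_rfl
  have heq : ∀ x ∈ Set.Icc 0 Real.pi, ∫ a in (0 : ℝ)..x, φ a = W x := by
    intro x hx
    have h1 := key 0 m0 x hx hx.1
    have h2 := key x hx _ mpi hx.2
    have h3 := intervalIntegral.integral_add_adjacent_intervals (hii x hx).1 (hii x hx).2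
    rw [hzero] at h3
    rw [hW0] at h1
    rw [hWpi] at h2
    linarith
  intro a ha
  rcases eq_or_lt_of_le ha.1 with h | h
  · rw [← h, h0]
  rcases eq_or_lt_of_le ha.2 with h' | h'
  · rw [h', hpi]
  have hφc : ContinuousOn φ (Set.Ioo 0 Real.pi) := by
    intro x hx
    have hs : Real.sin x ^ 2 ≠ 0 := pow_ne_zero 2 (Real.sin_pos_of_pos_of_lt_pi hx.1 hx.2).ne'
    apply ContinuousAt.continuousWithinAt
    apply ContinuousAt.mul (by fun_prop)
    exact ContinuousAt.div (by fun_prop) (by fun_prop) hs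
  have hnh : Set.Ioo 0 Real.pi ∈ 𝓝 a := Ioo_mem_nhds h h'
  have hd1 : HasDerivAt (fun x => ∫ t in (0 : ℝ)..x, φ t) (φ a) a := by
    refine intervalIntegral.integral_hasDerivAt_right (hii a ha).1 ?_ (hφc.continuousAt hnh)
    exact hφc.stronglyMeasurableAtFilter isOpen_Ioo a ⟨h, h'⟩
  have hd2 : HasDerivAt W (φ a) a := by
    refine hd1.congr_of_eventuallyEq ?_
    filter_upwards [hnh] with x hx
    exact (heq x ⟨hx.1.le, hx.2.le⟩).symm
  have hu := (hWd a ⟨h, h'⟩).unique hd2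
  by_contra hne
  have hs := Real.sin_pos_of_pos_of_lt_pi h h'
  have := div_pos (arcDefect_pos ⟨h, h'⟩ (hbmem a ha) hne) (pow_pos hs 3)
  linarith

theorem circleMap_one_eq_iff {a b : ℝ} :
    circleMap 0 1 a = circleMap 0 1 b ↔ ∃ n : ℤ, a = b + n * (2 * Real.pi) := by
  rw [circleMap_eq_circleMap_iff 0 one_ne_zero]
  refine exists_congr fun n => ?_
  rw [show (b : ℂ) * Complex.I + n * (2 * Real.pi * Complex.I)
    = ((b + n * (2 * Real.pi) : ℝ) : ℂ) * Complex.I by push_cast; ring,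
    mul_left_inj' Complex.I_ne_zero, Complex.ofReal_inj]

theorem norm_circleMap_one (t : ℝ) : ‖circleMap 0 1 t‖ = 1 := by simp

theorem circleMap_one_add_pi_ne (t : ℝ) : circleMap 0 1 t ≠ circleMap 0 1 (t + Real.pi) := by
  intro h
  obtain ⟨n, hn⟩ := circleMap_one_eq_iff.1 h
  have h1 : ((1 + 2 * n : ℤ) : ℝ) = 0 := by
    have : (1 + 2 * (n : ℝ)) * Real.pi = 0 := by linarith
    push_cast
    exact (mul_eq_zero.1 this).resolve_right Real.pi_ne_zero
  have h2 : (1 + 2 * n : ℤ) = 0 := by exact_mod_cast h1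
  omega

theorem exists_circleMap_one_eq {z : ℂ} (hz : ‖z‖ = 1) : ∃ t, circleMap 0 1 t = z :=
  ⟨z.arg, by
    rw [circleMap_zero, Complex.ofReal_one, one_mul]
    have := Complex.norm_mul_exp_arg_mul_I z
    rwa [hz, Complex.ofReal_one, one_mul] at this⟩

/-- A one-dimensional Borsuk–Ulam theorem. -/
theorem exists_eq_add_pi {h : ℝ → ℝ} (hc : Continuous h)
    (hp : Function.Periodic h (2 * Real.pi)) : ∃ t, h t = h (t + Real.pi) := by
  have hd : Continuous fun t => h (t + Real.pi) - h t := by fun_prop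
  have e : h (Real.pi + Real.pi) - h Real.pi = -(h (0 + Real.pi) - h 0) := by
    rw [show Real.pi + Real.pi = 0 + 2 * Real.pi by ring, hp 0, zero_add]; ring
  have hz : (0 : ℝ) ∈ Set.range fun t => h (t + Real.pi) - h t := by
    rcases le_total 0 (h (0 + Real.pi) - h 0) with h0 | h0
    · exact mem_range_of_exists_le_of_exists_ge hd ⟨Real.pi, by linarith⟩ ⟨0, h0⟩
    · exact mem_range_of_exists_le_of_exists_ge hd ⟨0, h0⟩ ⟨Real.pi, by linarith⟩
  obtain ⟨t, ht⟩ := hz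
  exact ⟨t, by simp only at ht; linarith⟩

/-- An injective continuous self-map of the circle is onto. -/
theorem surjOn_sphere_of_injOn {g : ℂ → ℂ} (hg : ContinuousOn g (Metric.sphere 0 1))
    (hm : Set.MapsTo g (Metric.sphere 0 1) (Metric.sphere 0 1))
    (hi : Set.InjOn g (Metric.sphere 0 1)) :
    Set.SurjOn g (Metric.sphere 0 1) (Metric.sphere 0 1) := by
  intro p hp
  by_contra hn
  have hmem : ∀ t, circleMap 0 1 t ∈ Metric.sphere (0 : ℂ) 1 := fun t => by simp
  have hnorm : ∀ t, ‖g (circleMap 0 1 t)‖ = 1 := fun t => by simpa using hm (hmem t)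
  have hpn : ‖p‖ = 1 := by simpa using hp
  have hp0 : p ≠ 0 := by rw [← norm_ne_zero_iff, hpn]; norm_num
  have hqn : ∀ t, ‖-g (circleMap 0 1 t) / p‖ = 1 := fun t => by simp [hnorm, hpn]
  have hslit : ∀ t, -g (circleMap 0 1 t) / p ∈ Complex.slitPlane := by
    intro t
    rw [Complex.mem_slitPlane_iff_arg]
    refine ⟨fun ha => hn ⟨_, hmem t, ?_⟩, by rw [← norm_ne_zero_iff, hqn]; norm_num⟩
    have := Complex.norm_mul_exp_arg_mul_I (-g (circleMap 0 1 t) / p)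
    rw [ha, hqn, Complex.exp_pi_mul_I, eq_div_iff hp0] at this
    simpa using this.symm
  have hgc : Continuous fun t => g (circleMap 0 1 t) :=
    hg.comp_continuous (continuous_circleMap 0 1) hmem
  have hc : Continuous fun t => (-g (circleMap 0 1 t) / p).arg :=
    continuous_iff_continuousAt.2 fun t =>
      ContinuousAt.comp (f := fun t => -g (circleMap 0 1 t) / p)
        (Complex.continuousAt_arg (hslit t)) (hgc.neg.div_const p).continuousAt
  obtain ⟨t, ht⟩ := exists_eq_add_pi hc fun t => by simp only [periodic_circleMap 0 1 t]
  have := Complex.ext_norm_arg ((hqn t).trans (hqn _).symm) ht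
  rw [div_left_inj' hp0, neg_inj] at this
  exact circleMap_one_add_pi_ne t (hi (hmem _) (hmem _) this)

/-- A differentiable unimodular curve has a differentiable argument. -/
theorem exists_hasDerivAt_arg {γ γ' : ℝ → ℂ} (hγ : ∀ t, HasDerivAt γ (γ' t) t)
    (hγ' : Continuous γ') (hn : ∀ t, ‖γ t‖ = 1) :
    ∃ φ φ' : ℝ → ℝ, (∀ t, HasDerivAt φ (φ' t) t) ∧ Continuous φ' ∧
      (∀ t, γ t = circleMap 0 1 (φ t)) ∧ ∀ t, γ' t = Complex.I * φ' t * γ t := by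
  have hγc : Continuous γ := continuous_iff_continuousAt.2 fun t => (hγ t).continuousAt
  have hunit : ∀ t, γ t * (starRingEnd ℂ) (γ t) = 1 := fun t => by
    rw [Complex.mul_conj, Complex.normSq_eq_norm_sq, hn]; norm_num
  have hre : ∀ t, (γ' t * (starRingEnd ℂ) (γ t)).re = 0 := by
    intro t
    have h1 := (hγ t).mul (hγ t).star
    have h2 : HasDerivAt (fun t => γ t * (starRingEnd ℂ) (γ t)) 0 t := by
      simp only [hunit]; exact hasDerivAt_const _ _
    have h3 := congrArg Complex.re (h1.unique h2)
    simp [Complex.mul_re, Complex.add_re] at h3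
    simp [Complex.mul_re]
    linarith
  set φ' : ℝ → ℝ := fun t => (γ' t * (starRingEnd ℂ) (γ t)).im with hφ'
  have hφc : Continuous φ' := Complex.continuous_im.comp
    (hγ'.mul (Complex.continuous_conj.comp hγc))
  have hder : ∀ t, γ' t = Complex.I * φ' t * γ t := by
    intro t
    have h1 : γ' t * (starRingEnd ℂ) (γ t) = Complex.I * φ' t := by
      apply Complex.ext
      · simpa using hre t
      · simp [hφ']
    rw [← h1, mul_assoc, mul_comm ((starRingEnd ℂ) _), hunit, mul_one]
  set φ : ℝ → ℝ := fun t => (γ 0).arg + ∫ s in (0 : ℝ)..t, φ' s with hφ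
  have hφd : ∀ t, HasDerivAt φ (φ' t) t := fun t =>
    ((hφc.integral_hasStrictDerivAt 0 t).hasDerivAt).const_add _
  refine ⟨φ, φ', hφd, hφc, fun t => ?_, hder⟩
  have hE : ∀ t, HasDerivAt (fun t => γ t * Complex.exp (-(φ t * Complex.I))) 0 t := by
    intro t
    have h1 := (hγ t).mul ((((hφd t).ofReal_comp).mul_const Complex.I).neg.cexp)
    refine h1.congr_deriv ?_
    rw [hder t]
    simp only [Pi.neg_apply]
    ring
  have hconst := is_const_of_deriv_eq_zero (fun t => (hE t).differentiableAt)
    (fun t => (hE t).deriv) t 0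
  have h0 : γ 0 = Complex.exp (φ 0 * Complex.I) := by
    have := Complex.norm_mul_exp_arg_mul_I (γ 0)
    rw [hn] at this
    simpa [hφ] using this.symm
  beta_reduce at hconst
  rw [h0, ← Complex.exp_add, add_neg_cancel, Complex.exp_zero, Complex.exp_neg] at hconst
  rw [circleMap_zero, Complex.ofReal_one, one_mul]
  field_simp at hconst
  exact hconst

theorem add_int_mul_of_add_two_pi {φ : ℝ → ℝ} {c : ℝ}
    (hk : ∀ t, φ (t + 2 * Real.pi) = φ t + c) (t : ℝ) (n : ℤ) :
    φ (t + n * (2 * Real.pi)) = φ t + n * c := by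
  have hp : Function.Periodic (fun t => φ t - c / (2 * Real.pi) * t) (2 * Real.pi) := by
    intro t
    simp only [hk]
    have := Real.pi_ne_zero
    field_simp
    ring
  have := hp.int_mul n t
  beta_reduce at this
  have e : c / (2 * Real.pi) * (t + n * (2 * Real.pi)) = c / (2 * Real.pi) * t + n * c := by
    have := Real.pi_ne_zero
    field_simp
  linarith

/-- The argument of a simple closed parametrisation of the circle is monotone and has total
variation `2 * π` over a period. -/
theorem arg_of_simple_closed {φ : ℝ → ℝ} {c : ℝ} (hc : Continuous φ)
    (hk : ∀ t, φ (t + 2 * Real.pi) = φ t + c)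
    (hiff : ∀ s t, circleMap 0 1 (φ s) = circleMap 0 1 (φ t) ↔
      circleMap 0 1 s = circleMap 0 1 t) :
    (StrictMono φ ∧ c = 2 * Real.pi) ∨ (StrictAnti φ ∧ c = -(2 * Real.pi)) := by
  have hc0 : c ≠ 0 := by
    intro h
    obtain ⟨t, ht⟩ := exists_eq_add_pi hc fun t => by rw [hk, h, add_zero]
    exact circleMap_one_add_pi_ne t ((hiff _ _).1 (by rw [ht]))
  have hinj : Function.Injective φ := by
    intro s t hst
    obtain ⟨n, hn⟩ := circleMap_one_eq_iff.1 ((hiff s t).1 (by rw [hst]))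
    rw [hn, add_int_mul_of_add_two_pi hk] at hst
    have : (n : ℝ) = 0 := by
      have : (n : ℝ) * c = 0 := by linarith
      exact (mul_eq_zero.1 this).resolve_right hc0
    rw [hn, this]; ring
  have main : ∀ (ψ : ℝ → ℝ) (d : ℝ), Continuous ψ → StrictMono ψ →
      (∀ t, ψ (t + 2 * Real.pi) = ψ t + d) →
      (∀ s t, circleMap 0 1 (ψ s) = circleMap 0 1 (ψ t) ↔
        circleMap 0 1 s = circleMap 0 1 t) → d = 2 * Real.pi := by
    intro ψ d hψ hmono hd hψiff
    have hpi := Real.pi_pos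
    have h0 : ψ (2 * Real.pi) = ψ 0 + d := by simpa using hd 0
    have hdpos : 0 < d := by
      have := hmono (show (0 : ℝ) < 2 * Real.pi by positivity)
      linarith
    obtain ⟨n, hn⟩ := circleMap_one_eq_iff.1
      ((hψiff (2 * Real.pi) 0).2 (by simpa using periodic_circleMap 0 1 0))
    have hdn : d = n * (2 * Real.pi) := by linarith
    have hn1 : 0 < n := by
      by_contra hcon
      have : (n : ℝ) ≤ 0 := by exact_mod_cast not_lt.1 hcon
      nlinarith
    have hn2 : n < 2 := by
      by_contra hcon
      have hn2' : (2 : ℝ) ≤ n := by exact_mod_cast not_lt.1 hcon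
      have hmem : ψ 0 + 2 * Real.pi ∈ Set.Ioo (ψ 0) (ψ (2 * Real.pi)) :=
        ⟨by linarith, by rw [h0, hdn]; nlinarith⟩
      obtain ⟨t, ht, hte⟩ := intermediate_value_Ioo (by positivity) hψ.continuousOn hmem
      obtain ⟨m, hm⟩ := circleMap_one_eq_iff.1 ((hψiff t 0).1 (by
        rw [hte, periodic_circleMap 0 1]))
      rw [zero_add] at hm
      have m1 : (0 : ℝ) < m := by
        by_contra hcon
        have := ht.1
        nlinarith [not_lt.1 hcon]
      have m2 : (m : ℝ) < 1 := by
        by_contra hcon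
        have := ht.2
        nlinarith [not_lt.1 hcon]
      have m1' : 0 < m := by exact_mod_cast m1
      have m2' : m < 1 := by exact_mod_cast m2
      omega
    have : n = 1 := by omega
    rw [hdn, this]; simp
  rcases hc.strictMono_of_inj hinj with h | h
  · exact Or.inl ⟨h, main φ c hc h hk hiff⟩
  · refine Or.inr ⟨h, ?_⟩
    have := main (fun t => -φ t) (-c) hc.neg h.neg (fun t => by rw [hk]; ring) (fun s t => by
      have e : ∀ x : ℝ, circleMap 0 1 (-x) = (starRingEnd ℂ) (circleMap 0 1 x) := fun x =>
        (conj_circleMap_zero 1 x).symm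
      rw [e, e, (starRingEnd ℂ).injective.eq_iff]
      exact hiff s t)
    linarith

/-- A `C¹` simple closed parametrisation of the circle has, up to complex conjugation,
a nondecreasing `C¹` argument. -/
theorem exists_monotone_arg {γ γ' : ℝ → ℂ} (hγ : ∀ t, HasDerivAt γ (γ' t) t)
    (hγ' : Continuous γ') (hn : ∀ t, ‖γ t‖ = 1)
    (hiff : ∀ s t, γ s = γ t ↔ circleMap 0 1 s = circleMap 0 1 t) :
    ∃ ψ ψ' : ℝ → ℝ, (∀ t, HasDerivAt ψ (ψ' t) t) ∧ Continuous ψ' ∧ (∀ t, 0 ≤ ψ' t) ∧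
      (∀ t, ψ (t + 2 * Real.pi) = ψ t + 2 * Real.pi) ∧
      ((∀ t, γ t = circleMap 0 1 (ψ t)) ∨ ∀ t, γ t = (starRingEnd ℂ) (circleMap 0 1 (ψ t))) ∧
      ∃ σ : ℝ, |σ| = 1 ∧ ∀ t, γ' t = Complex.I * (σ * ψ' t : ℝ) * γ t := by
  obtain ⟨φ, φ', hφ, hφc, he, hd⟩ := exists_hasDerivAt_arg hγ hγ' hn
  have hper : ∀ t, γ (t + 2 * Real.pi) = γ t := fun t => (hiff _ _).2 (periodic_circleMap 0 1 t)
  have hdper : ∀ t, φ' (t + 2 * Real.pi) = φ' t := by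
    intro t
    have h1 : γ' (t + 2 * Real.pi) = γ' t := by
      have h2 := (hγ (t + 2 * Real.pi)).comp_add_const t (2 * Real.pi)
      simp only [hper] at h2
      exact h2.unique (hγ t)
    have hne : γ t ≠ 0 := by rw [← norm_ne_zero_iff, hn]; norm_num
    rw [hd, hd, hper, mul_left_inj' hne, mul_right_inj' Complex.I_ne_zero,
      Complex.ofReal_inj] at h1
    exact h1
  have hφcont : Continuous φ := continuous_iff_continuousAt.2 fun t => (hφ t).continuousAt
  have hk : ∀ t, φ (t + 2 * Real.pi) = φ t + (φ (2 * Real.pi) - φ 0) := by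
    intro t
    have hD : ∀ t, HasDerivAt (fun t => φ (t + 2 * Real.pi) - φ t) 0 t := fun t =>
      (((hφ (t + 2 * Real.pi)).comp_add_const t (2 * Real.pi)).sub (hφ t)).congr_deriv
        (by rw [hdper, sub_self])
    have := is_const_of_deriv_eq_zero (fun t => (hD t).differentiableAt) (fun t => (hD t).deriv) t 0
    simp only [zero_add] at this
    linarith
  have hiff' : ∀ s t, circleMap 0 1 (φ s) = circleMap 0 1 (φ t) ↔
      circleMap 0 1 s = circleMap 0 1 t := fun s t => by rw [← he, ← he, hiff]
  rcases arg_of_simple_closed hφcont hk hiff' with ⟨hm, hc⟩ | ⟨hm, hc⟩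
  · refine ⟨φ, φ', hφ, hφc, fun t => ?_, fun t => by rw [hk, hc], Or.inl he, 1, by simp, ?_⟩
    · rw [← (hφ t).deriv]; exact hm.monotone.deriv_nonneg
    · intro t; rw [one_mul]; exact hd t
  · refine ⟨fun t => -φ t, fun t => -φ' t, fun t => (hφ t).neg, hφc.neg, fun t => ?_,
      fun t => by beta_reduce; rw [hk, hc]; ring, Or.inr fun t => ?_, -1, by simp, ?_⟩
    · beta_reduce; rw [← (hφ t).neg.deriv]; exact hm.neg.monotone.deriv_nonneg
    · rw [he, conj_circleMap_zero, neg_neg]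
    · intro t; rw [neg_one_mul, neg_neg]; exact hd t

theorem apply_eq_re_mul_add_im_mul (A : ℂ →L[ℝ] ℂ) (z : ℂ) :
    A z = z.re * A 1 + z.im * A Complex.I := by
  have h : z = z.re • (1 : ℂ) + z.im • Complex.I := by simp
  conv_lhs => rw [h]
  simp only [map_add, map_smul]
  simp only [Complex.real_smul]

theorem det_eq_im_conj_mul (A : ℂ →L[ℝ] ℂ) :
    A.det = ((starRingEnd ℂ) (A 1) * A Complex.I).im := by
  rw [ContinuousLinearMap.det, ← LinearMap.det_toMatrix Complex.basisOneI, Matrix.det_fin_two]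
  simp [LinearMap.toMatrix_apply, Complex.coe_basisOneI]
  ring

theorem det_eq_im_conj_mul_of_norm_eq_one (A : ℂ →L[ℝ] ℂ) {z : ℂ} (hz : ‖z‖ = 1) :
    A.det = ((starRingEnd ℂ) (A z) * A (z * Complex.I)).im := by
  have h1 : z.re ^ 2 + z.im ^ 2 = 1 := by
    have := Complex.sq_norm z
    rw [hz, Complex.normSq_apply] at this
    linarith
  rw [det_eq_im_conj_mul, apply_eq_re_mul_add_im_mul A z, apply_eq_re_mul_add_im_mul A (z * Complex.I)]
  simp [Complex.mul_im, Complex.mul_re]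
  linear_combination (-(A 1).re * (A Complex.I).im + (A 1).im * (A Complex.I).re) * h1

theorem two_mul_abs_det_le_hsNormSq (A : ℂ →L[ℝ] ℂ) : 2 * |A.det| ≤ hsNormSq A := by
  have h : |A.det| ≤ ‖A 1‖ * ‖A Complex.I‖ := by
    rw [det_eq_im_conj_mul]
    refine (Complex.abs_im_le_norm _).trans ?_
    rw [norm_mul, Complex.norm_conj]
  unfold hsNormSq
  nlinarith [sq_nonneg (‖A 1‖ - ‖A Complex.I‖)]

theorem convex_closedUnitDisk : Convex ℝ closedUnitDisk := convex_closedBall _ _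

theorem isCompact_closedUnitDisk : IsCompact closedUnitDisk := isCompact_closedBall _ _

theorem uniqueDiffOn_closedUnitDisk : UniqueDiffOn ℝ closedUnitDisk :=
  uniqueDiffOn_convex convex_closedUnitDisk
    ⟨0, by rw [closedUnitDisk, interior_closedBall _ one_ne_zero]; simp⟩

theorem closure_openUnitDisk : closure openUnitDisk = closedUnitDisk := closure_ball _ one_ne_zero

theorem openUnitDisk_subset : openUnitDisk ⊆ closedUnitDisk := Metric.ball_subset_closedBall

theorem closedUnitDisk_mem_nhds {z : ℂ} (hz : z ∈ openUnitDisk) : closedUnitDisk ∈ nhds z :=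
  Filter.mem_of_superset (Metric.isOpen_ball.mem_nhds hz) openUnitDisk_subset

theorem circleMap_mem_closedUnitDisk {r : ℝ} (h0 : 0 ≤ r) (h1 : r ≤ 1) (t : ℝ) :
    circleMap 0 r t ∈ closedUnitDisk := by
  simp [closedUnitDisk, abs_of_nonneg h0, h1]

theorem circleMap_mem_openUnitDisk {r : ℝ} (h0 : 0 ≤ r) (h1 : r < 1) (t : ℝ) :
    circleMap 0 r t ∈ openUnitDisk := by
  simp [openUnitDisk, abs_of_nonneg h0, h1]

section C1
variable {f : ℂ → ℂ}

theorem hasFDerivWithinAt_diskDeriv (hC1 : ContDiffOn ℝ 1 f closedUnitDisk) {z : ℂ}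
    (hz : z ∈ closedUnitDisk) : HasFDerivWithinAt f (diskDeriv f z) closedUnitDisk z :=
  (hC1.differentiableOn one_ne_zero z hz).hasFDerivWithinAt

theorem continuousOn_diskDeriv (hC1 : ContDiffOn ℝ 1 f closedUnitDisk) :
    ContinuousOn (diskDeriv f) closedUnitDisk :=
  hC1.continuousOn_fderivWithin uniqueDiffOn_closedUnitDisk le_rfl

theorem continuousOn_hsNormSq_diskDeriv (hC1 : ContDiffOn ℝ 1 f closedUnitDisk) :
    ContinuousOn (fun z => hsNormSq (diskDeriv f z)) closedUnitDisk := by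
  have h := continuousOn_diskDeriv hC1
  unfold hsNormSq
  exact ((h.clm_apply continuousOn_const).norm.pow 2).add
    ((h.clm_apply continuousOn_const).norm.pow 2)

theorem continuousOn_det_diskDeriv (hC1 : ContDiffOn ℝ 1 f closedUnitDisk) :
    ContinuousOn (fun z => (diskDeriv f z).det) closedUnitDisk :=
  ContinuousLinearMap.continuous_det.comp_continuousOn (continuousOn_diskDeriv hC1)

theorem hasDerivAt_boundary (hC1 : ContDiffOn ℝ 1 f closedUnitDisk) (t : ℝ) :
    HasDerivAt (fun t => f (circleMap 0 1 t))
      (diskDeriv f (circleMap 0 1 t) (circleMap 0 1 t * Complex.I)) t := by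
  have h1 := hasFDerivWithinAt_diskDeriv hC1 (circleMap_mem_closedUnitDisk zero_le_one le_rfl t)
  have h2 := h1.comp_hasDerivWithinAt (s := Set.univ) t
    (hasDerivAt_circleMap 0 1 t).hasDerivWithinAt
    (fun s _ => circleMap_mem_closedUnitDisk zero_le_one le_rfl s)
  exact hasDerivWithinAt_univ.1 h2

theorem exists_lipschitzOnWith (hC1 : ContDiffOn ℝ 1 f closedUnitDisk) :
    ∃ C : NNReal, LipschitzOnWith C f closedUnitDisk := by
  obtain ⟨C, hC⟩ := isCompact_closedUnitDisk.exists_bound_of_continuousOn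
    (continuousOn_diskDeriv hC1)
  refine ⟨C.toNNReal, convex_closedUnitDisk.lipschitzOnWith_of_nnnorm_fderivWithin_le
    (hC1.differentiableOn one_ne_zero) fun z hz => ?_⟩
  rw [← NNReal.coe_le_coe, coe_nnnorm]
  exact (hC z hz).trans (Real.le_coe_toNNReal C)

theorem two_mul_diskJacobian_le (hC1 : ContDiffOn ℝ 1 f closedUnitDisk) :
    2 * diskJacobian f ≤ diskEnergy f := by
  unfold diskJacobian diskEnergy
  rw [← MeasureTheory.integral_const_mul]
  have i1 : MeasureTheory.IntegrableOn (fun z => 2 * |(diskDeriv f z).det|) openUnitDisk :=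
    ((continuousOn_const.mul (continuousOn_det_diskDeriv hC1).abs).integrableOn_compact
      isCompact_closedUnitDisk).mono_set openUnitDisk_subset
  have i2 : MeasureTheory.IntegrableOn (fun z => hsNormSq (diskDeriv f z)) openUnitDisk :=
    ((continuousOn_hsNormSq_diskDeriv hC1).integrableOn_compact
      isCompact_closedUnitDisk).mono_set openUnitDisk_subset
  exact MeasureTheory.setIntegral_mono i1 i2 fun z => two_mul_abs_det_le_hsNormSq _

theorem diskJacobian_eq_pi (hC1 : ContDiffOn ℝ 1 f closedUnitDisk)
    (hb : Set.BijOn f closedUnitDisk closedUnitDisk) : diskJacobian f = Real.pi := by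
  have hae : openUnitDisk =ᵐ[MeasureTheory.volume] closedUnitDisk := by
    rw [← closure_openUnitDisk]
    exact MeasureTheory.ae_eq_set.2 ⟨by simp [Set.sdiff_eq_empty.2 subset_closure], by
      rw [closure_openUnitDisk, closedUnitDisk, openUnitDisk, Metric.closedBall_sdiff_ball]
      exact MeasureTheory.Measure.addHaar_sphere _ _ _⟩
  have hm : MeasurableSet closedUnitDisk := Metric.isClosed_closedBall.measurableSet
  have h := MeasureTheory.lintegral_abs_det_fderiv_eq_addHaar_image MeasureTheory.volume hm
    (fun z hz => hasFDerivWithinAt_diskDeriv hC1 hz) hb.injOn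
  rw [hb.image_eq] at h
  rw [diskJacobian, MeasureTheory.setIntegral_congr_set hae,
    MeasureTheory.integral_eq_lintegral_of_nonneg_ae (Filter.Eventually.of_forall fun _ => abs_nonneg _)
    ((continuousOn_det_diskDeriv hC1).abs.aestronglyMeasurable hm), h, closedUnitDisk,
    Complex.volume_closedBall]
  simp

end C1

theorem mapsTo_openUnitDisk {f : ℂ → ℂ} (hharm : InnerProductSpace.HarmonicOnNhd f openUnitDisk)
    (hm : Set.MapsTo f closedUnitDisk closedUnitDisk) (hi : Set.InjOn f closedUnitDisk) :
    Set.MapsTo f openUnitDisk openUnitDisk := by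
  intro z hz
  by_contra hcon
  have hle : ∀ w ∈ closedUnitDisk, ‖f w‖ ≤ 1 := fun w hw => by
    simpa [closedUnitDisk] using hm hw
  have hfz : ‖f z‖ = 1 := le_antisymm (hle z (openUnitDisk_subset hz))
    (by simpa [openUnitDisk] using hcon)
  set l : ℂ →L[ℝ] ℝ := Complex.reCLM.comp
    ((ContinuousLinearMap.mul ℝ ℂ) ((starRingEnd ℂ) (f z))) with hl
  have hlv : ∀ w, l w = ((starRingEnd ℂ) (f z) * w).re := fun w => by simp [hl]
  obtain ⟨F, hF, hFe⟩ := (hharm.comp_CLM l).exists_analyticOnNhd_ball_re_eq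
  have hFd : DifferentiableOn ℂ (fun w => Complex.exp (F w)) openUnitDisk :=
    hF.differentiableOn.cexp
  have hre : ∀ w ∈ openUnitDisk, (F w).re = ((starRingEnd ℂ) (f z) * f w).re := fun w hw => by
    rw [← hlv]; exact hFe hw
  have hz1 : ((starRingEnd ℂ) (f z) * f z).re = 1 := by
    rw [mul_comm, Complex.mul_conj, Complex.normSq_eq_norm_sq, hfz]; norm_num
  have hle1 : ∀ w ∈ openUnitDisk, ((starRingEnd ℂ) (f z) * f w).re ≤ 1 := fun w hw => by
    refine (Complex.re_le_norm _).trans ?_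
    rw [norm_mul, Complex.norm_conj, hfz, one_mul]
    exact hle w (openUnitDisk_subset hw)
  have hmax : IsMaxOn (norm ∘ fun w => Complex.exp (F w)) openUnitDisk z := by
    intro w hw
    simp only [Set.mem_ofPred_eq, Function.comp_apply, Complex.norm_exp, Real.exp_le_exp]
    rw [hre w hw, hre z hz, hz1]
    exact hle1 w hw
  have heq := Complex.norm_eqOn_of_isPreconnected_of_isMaxOn
    (convex_ball (0 : ℂ) 1).isPreconnected Metric.isOpen_ball hFd hz hmax
  have hconst : ∀ w ∈ openUnitDisk, f w = f z := by
    intro w hw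
    have h1 := heq hw
    simp only [Function.comp_apply, Function.const_apply, Complex.norm_exp, Real.exp_eq_exp] at h1
    rw [hre w hw, hre z hz, hz1] at h1
    have h2 : ‖f w - f z‖ ^ 2 ≤ 0 := by
      rw [Complex.sq_norm, Complex.normSq_sub, Complex.normSq_eq_norm_sq,
        Complex.normSq_eq_norm_sq, hfz, mul_comm (f w), h1]
      have := hle w (openUnitDisk_subset hw)
      nlinarith [norm_nonneg (f w)]
    have h3 : ‖f w - f z‖ = 0 := by nlinarith [norm_nonneg (f w - f z)]
    exact sub_eq_zero.1 (norm_eq_zero.1 h3)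
  have h0 : (0 : ℂ) ∈ openUnitDisk := by simp [openUnitDisk]
  have h2 : (1 / 2 : ℂ) ∈ openUnitDisk := by simp [openUnitDisk]; norm_num
  have := hi (openUnitDisk_subset h0) (openUnitDisk_subset h2)
    ((hconst 0 h0).trans (hconst _ h2).symm)
  norm_num at this

theorem mapsTo_sphere {f : ℂ → ℂ} (hhomeo : IsHomeomorphOnto f closedUnitDisk closedUnitDisk)
    (hharm : InnerProductSpace.HarmonicOnNhd f openUnitDisk) :
    Set.MapsTo f (Metric.sphere 0 1) (Metric.sphere 0 1) := by
  obtain ⟨hb, -, hinv⟩ := hhomeo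
  set g := Function.invFunOn f closedUnitDisk
  have hsub : Metric.sphere (0 : ℂ) 1 ⊆ closedUnitDisk := Metric.sphere_subset_closedBall
  have hright : ∀ w ∈ closedUnitDisk, f (g w) = w := fun w hw =>
    Function.invFunOn_eq (hb.surjOn hw)
  have hmem : ∀ w ∈ closedUnitDisk, g w ∈ closedUnitDisk := fun w hw =>
    Function.invFunOn_mem (hb.surjOn hw)
  have hopen := mapsTo_openUnitDisk hharm hb.mapsTo hb.injOn
  have hgm : Set.MapsTo g (Metric.sphere 0 1) (Metric.sphere 0 1) := by
    intro w hw
    have h1 := hmem w (hsub hw)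
    by_contra hcon
    have h2 : g w ∈ openUnitDisk := by
      simp only [closedUnitDisk, openUnitDisk, Metric.mem_closedBall, Metric.mem_ball,
        Metric.mem_sphere] at *
      exact lt_of_le_of_ne h1 hcon
    have h3 := hopen h2
    rw [hright w (hsub hw)] at h3
    simp only [openUnitDisk, Metric.mem_ball, Metric.mem_sphere] at *
    linarith
  have hgi : Set.InjOn g (Metric.sphere 0 1) := fun v hv w hw h => by
    rw [← hright v (hsub hv), h, hright w (hsub hw)]
  intro p hp
  obtain ⟨w, hw, rfl⟩ := surjOn_sphere_of_injOn (hinv.mono hsub) hgm hgi hp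
  rwa [hright w (hsub hw)]

open MeasureTheory in
theorem setIntegral_openUnitDisk_eq_polar {g : ℂ → ℝ} (hg : ContinuousOn g closedUnitDisk) :
    ∫ z in openUnitDisk, g z = 2 * Real.pi * ∫ r in (0 : ℝ)..1, r * Real.circleAverage g 0 r := by
  have hcirc : ∀ p : ℝ × ℝ, Complex.polarCoord.symm p = circleMap 0 p.1 p.2 := fun p => by
    rw [Complex.polarCoord_symm_apply, circleMap_zero, Complex.exp_mul_I]; push_cast; rfl
  have hint : IntegrableOn (fun p : ℝ × ℝ => p.1 * g (circleMap 0 p.1 p.2))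
      (Set.Ioo 0 1 ×ˢ Set.Ioo (-Real.pi) Real.pi) (volume.prod volume) := by
    have hc : ContinuousOn (fun p : ℝ × ℝ => p.1 * g (circleMap 0 p.1 p.2))
        (Set.Icc 0 1 ×ˢ Set.Icc (-Real.pi) Real.pi) := by
      refine continuousOn_fst.mul (hg.comp ?_ ?_)
      · simp only [circleMap_zero]; fun_prop
      · intro p hp
        exact circleMap_mem_closedUnitDisk hp.1.1 hp.1.2 _
    exact (hc.integrableOn_compact (isCompact_Icc.prod isCompact_Icc)).mono_set
      (Set.prod_mono Set.Ioo_subset_Icc_self Set.Ioo_subset_Icc_self)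
  have h1 : ∫ z in openUnitDisk, g z
      = ∫ p in Set.Ioo 0 1 ×ˢ Set.Ioo (-Real.pi) Real.pi, p.1 * g (circleMap 0 p.1 p.2) := by
    have hms : MeasurableSet openUnitDisk := Metric.isOpen_ball.measurableSet
    rw [← integral_indicator hms,
      ← Complex.integral_comp_polarCoord_symm, polarCoord_target,
      ← integral_indicator (measurableSet_Ioi.prod measurableSet_Ioo),
      ← integral_indicator (measurableSet_Ioo.prod measurableSet_Ioo)]
    congr 1
    ext p
    by_cases hp : p ∈ Set.Ioi (0 : ℝ) ×ˢ Set.Ioo (-Real.pi) Real.pi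
    · rw [Set.indicator_of_mem hp, hcirc]
      by_cases h : p.1 < 1
      · rw [Set.indicator_of_mem (circleMap_mem_openUnitDisk (le_of_lt hp.1) h _),
          Set.indicator_of_mem (show p ∈ Set.Ioo (0 : ℝ) 1 ×ˢ Set.Ioo (-Real.pi) Real.pi from
            ⟨⟨hp.1, h⟩, hp.2⟩), smul_eq_mul]
      · rw [Set.indicator_of_notMem, Set.indicator_of_notMem, smul_zero]
        · exact fun hc => h hc.1.2
        · intro hc
          have h0 : (0 : ℝ) < p.1 := hp.1
          simp [openUnitDisk, abs_of_pos h0] at hc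
          exact h hc
    · rw [Set.indicator_of_notMem hp, Set.indicator_of_notMem]
      exact fun hc => hp ⟨hc.1.1, hc.2⟩
  rw [h1, Measure.volume_eq_prod, setIntegral_prod _ hint,
    intervalIntegral.integral_of_le zero_le_one, integral_Ioc_eq_integral_Ioo,
    ← integral_const_mul]
  refine setIntegral_congr_fun measurableSet_Ioo fun r _ => ?_
  rw [integral_const_mul, ← integral_Ioc_eq_integral_Ioo,
    ← intervalIntegral.integral_of_le (by linarith [Real.pi_pos]), Real.circleAverage, smul_eq_mul]
  have hper : Function.Periodic (fun t => g (circleMap 0 r t)) (2 * Real.pi) := fun t => by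
    beta_reduce; rw [periodic_circleMap]
  have := hper.intervalIntegral_add_eq (-Real.pi) 0
  rw [show -Real.pi + 2 * Real.pi = Real.pi by ring, zero_add] at this
  rw [this]
  have := Real.pi_ne_zero
  field_simp

/-- A complex-valued harmonic function on the disk is the sum of a holomorphic and an
antiholomorphic function. -/
theorem exists_analytic_add_conj {f : ℂ → ℂ}
    (hharm : InnerProductSpace.HarmonicOnNhd f openUnitDisk) :
    ∃ h g : ℂ → ℂ, AnalyticOnNhd ℂ h openUnitDisk ∧ AnalyticOnNhd ℂ g openUnitDisk ∧
      ∀ z ∈ openUnitDisk, f z = h z + (starRingEnd ℂ) (g z) := by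
  obtain ⟨P, hP, hPe⟩ := (hharm.comp_CLM Complex.reCLM).exists_analyticOnNhd_ball_re_eq
  obtain ⟨Q, hQ, hQe⟩ := (hharm.comp_CLM Complex.imCLM).exists_analyticOnNhd_ball_re_eq
  refine ⟨fun z => (1 / 2) * (P z + Complex.I * Q z), fun z => (1 / 2) * (P z - Complex.I * Q z),
    analyticOnNhd_const.mul (hP.add (analyticOnNhd_const.mul hQ)),
    analyticOnNhd_const.mul (hP.sub (analyticOnNhd_const.mul hQ)), fun z hz => ?_⟩
  have h1 : (P z).re = (f z).re := hPe hz
  have h2 : (Q z).re = (f z).im := hQe hz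
  apply Complex.ext <;> simp [← h1, ← h2] <;> ring

section Decomposition
variable {f h g : ℂ → ℂ}

theorem diskDeriv_eq_of_decomposition (hh : AnalyticOnNhd ℂ h openUnitDisk)
    (hg : AnalyticOnNhd ℂ g openUnitDisk)
    (hf : ∀ z ∈ openUnitDisk, f z = h z + (starRingEnd ℂ) (g z)) {z : ℂ} (hz : z ∈ openUnitDisk)
    (v : ℂ) : diskDeriv f z v = deriv h z * v + (starRingEnd ℂ) (deriv g z * v) := by
  have h1 := (hh z hz).differentiableAt.hasDerivAt.complexToReal_fderiv
  have h2 := (hg z hz).differentiableAt.hasDerivAt.complexToReal_fderiv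
  have h3 := h1.add ((Complex.conjCLE : ℂ →L[ℝ] ℂ).hasFDerivAt.comp z h2)
  have h4 : HasFDerivAt f _ z := h3.congr_of_eventuallyEq (by
    filter_upwards [Metric.isOpen_ball.mem_nhds hz] with w hw
    simpa using hf w hw)
  rw [diskDeriv, fderivWithin_of_mem_nhds (closedUnitDisk_mem_nhds hz), h4.fderiv]
  simp

theorem hsNormSq_eq_of_decomposition (hh : AnalyticOnNhd ℂ h openUnitDisk)
    (hg : AnalyticOnNhd ℂ g openUnitDisk)
    (hf : ∀ z ∈ openUnitDisk, f z = h z + (starRingEnd ℂ) (g z)) {z : ℂ} (hz : z ∈ openUnitDisk) :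
    hsNormSq (diskDeriv f z) = 2 * (‖deriv h z‖ ^ 2 + ‖deriv g z‖ ^ 2) := by
  rw [hsNormSq, diskDeriv_eq_of_decomposition hh hg hf hz,
    diskDeriv_eq_of_decomposition hh hg hf hz]
  simp only [Complex.sq_norm, Complex.normSq_apply]
  simp
  ring

/-- The radial derivative of `Re (conj f · r ∂f/∂r)`, expressed through the holomorphic and
antiholomorphic parts of `f`. -/
noncomputable def radialFluxDeriv (f h g : ℂ → ℂ) (z ζ : ℂ) : ℝ :=
  ((starRingEnd ℂ) (deriv h z * ζ + (starRingEnd ℂ) (deriv g z * ζ)) *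
    (z * deriv h z + (starRingEnd ℂ) (z * deriv g z)) + (starRingEnd ℂ) (f z) *
    (ζ * (deriv h z + z * deriv (deriv h) z) +
      (starRingEnd ℂ) (ζ * (deriv g z + z * deriv (deriv g) z)))).re

theorem hasDerivAt_circleMap_radius (r t : ℝ) :
    HasDerivAt (fun r : ℝ => circleMap 0 r t) (circleMap 0 1 t) r := by
  simp only [circleMap_zero]
  exact ((hasDerivAt_id r).ofReal_comp.mul_const _).congr_deriv (by simp)

theorem hasDerivAt_of_decomposition (hh : AnalyticOnNhd ℂ h openUnitDisk)
    (hg : AnalyticOnNhd ℂ g openUnitDisk)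
    (hf : ∀ z ∈ openUnitDisk, f z = h z + (starRingEnd ℂ) (g z)) {c : ℝ → ℂ} {c' : ℂ} {r : ℝ}
    (hc : HasDerivAt c c' r) (hz : c r ∈ openUnitDisk) :
    HasDerivAt (fun r => f (c r))
      (deriv h (c r) * c' + (starRingEnd ℂ) (deriv g (c r) * c')) r := by
  have h1 := (hh _ hz).differentiableAt.hasDerivAt.comp r hc
  have h2 := ((hg _ hz).differentiableAt.hasDerivAt.comp r hc).star
  refine (h1.add h2).congr_of_eventuallyEq ?_
  filter_upwards [hc.continuousAt.preimage_mem_nhds (Metric.isOpen_ball.mem_nhds hz)] with w hw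
  exact hf _ hw

theorem hasDerivAt_mul_deriv (hh : AnalyticOnNhd ℂ h openUnitDisk) {c : ℝ → ℂ} {c' : ℂ} {r : ℝ}
    (hc : HasDerivAt c c' r) (hz : c r ∈ openUnitDisk) :
    HasDerivAt (fun r => c r * deriv h (c r))
      (c' * (deriv h (c r) + c r * deriv (deriv h) (c r))) r := by
  refine (hc.mul ((hh.deriv _ hz).differentiableAt.hasDerivAt.comp r hc)).congr_deriv ?_
  simp only [Function.comp_apply]; ring

theorem HasDerivAt.re_complex {c : ℝ → ℂ} {c' : ℂ} {r : ℝ} (hc : HasDerivAt c c' r) :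
    HasDerivAt (fun r => (c r).re) c'.re r :=
  Complex.reCLM.hasFDerivAt.comp_hasDerivAt r hc

theorem hasDerivAt_radialFlux (hh : AnalyticOnNhd ℂ h openUnitDisk)
    (hg : AnalyticOnNhd ℂ g openUnitDisk)
    (hf : ∀ z ∈ openUnitDisk, f z = h z + (starRingEnd ℂ) (g z)) {r : ℝ} (hr : r ∈ Set.Ioo 0 1)
    (t : ℝ) :
    HasDerivAt (fun r => ((starRingEnd ℂ) (f (circleMap 0 r t)) *
      diskDeriv f (circleMap 0 r t) (circleMap 0 r t)).re)
      (radialFluxDeriv f h g (circleMap 0 r t) (circleMap 0 1 t)) r := by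
  have hz := circleMap_mem_openUnitDisk hr.1.le hr.2 t
  have hc := hasDerivAt_circleMap_radius r t
  have h1 := (hasDerivAt_of_decomposition hh hg hf hc hz).star.mul
    ((hasDerivAt_mul_deriv hh hc hz).add (hasDerivAt_mul_deriv hg hc hz).star)
  refine h1.re_complex.congr_of_eventuallyEq ?_
  filter_upwards [Ioo_mem_nhds hr.1 hr.2] with s hs
  rw [diskDeriv_eq_of_decomposition hh hg hf (circleMap_mem_openUnitDisk hs.1.le hs.2 t),
    mul_comm (deriv h _), mul_comm (deriv g _)]
  rfl

theorem hasDerivAt_tangentialFlux (hh : AnalyticOnNhd ℂ h openUnitDisk)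
    (hg : AnalyticOnNhd ℂ g openUnitDisk)
    (hf : ∀ z ∈ openUnitDisk, f z = h z + (starRingEnd ℂ) (g z)) {r : ℝ} (hr : r ∈ Set.Ioo 0 1)
    (t : ℝ) :
    HasDerivAt (fun t => ((starRingEnd ℂ) (f (circleMap 0 r t)) * (-Complex.I *
      (circleMap 0 r t * deriv h (circleMap 0 r t)
        - (starRingEnd ℂ) (circleMap 0 r t * deriv g (circleMap 0 r t))))).re)
      (r * radialFluxDeriv f h g (circleMap 0 r t) (circleMap 0 1 t)
        - r ^ 2 * hsNormSq (diskDeriv f (circleMap 0 r t))) t := by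
  have hz := circleMap_mem_openUnitDisk hr.1.le hr.2 t
  have hc := hasDerivAt_circleMap 0 r t
  have h1 := (hasDerivAt_of_decomposition hh hg hf hc hz).star.mul
    (((hasDerivAt_mul_deriv hh hc hz).sub (hasDerivAt_mul_deriv hg hc hz).star).const_mul
      (-Complex.I))
  refine h1.re_complex.congr_deriv ?_
  rw [hsNormSq_eq_of_decomposition hh hg hf hz, radialFluxDeriv]
  have e : circleMap 0 r t = r * circleMap 0 1 t := by simp [circleMap_zero]
  have e1 : (circleMap 0 1 t).re ^ 2 + (circleMap 0 1 t).im ^ 2 = 1 := by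
    have := Complex.sq_norm (circleMap 0 1 t)
    rw [norm_circleMap_one, Complex.normSq_apply] at this
    linarith
  simp only [Pi.sub_apply]
  generalize deriv h (circleMap 0 r t) = a
  generalize deriv g (circleMap 0 r t) = b
  generalize deriv (deriv h) (circleMap 0 r t) = a'
  generalize deriv (deriv g) (circleMap 0 r t) = b'
  generalize f (circleMap 0 r t) = w
  rw [e]
  generalize circleMap 0 1 t = ζ at *
  simp only [Complex.sq_norm, Complex.normSq_apply]
  simp
  linear_combination (-2 * r ^ 2 * (a.re ^ 2 + a.im ^ 2 + b.re ^ 2 + b.im ^ 2)) * e1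

open MeasureTheory Topology in
theorem hasDerivAt_circleAverage_radialFlux (hh : AnalyticOnNhd ℂ h openUnitDisk)
    (hg : AnalyticOnNhd ℂ g openUnitDisk)
    (hf : ∀ z ∈ openUnitDisk, f z = h z + (starRingEnd ℂ) (g z)) {r : ℝ} (hr : r ∈ Set.Ioo 0 1) :
    HasDerivAt (fun r => Real.circleAverage
        (fun z => ((starRingEnd ℂ) (f z) * diskDeriv f z z).re) 0 r)
      (r * Real.circleAverage (fun z => hsNormSq (diskDeriv f z)) 0 r) r := by
  have hfc : ContinuousOn f openUnitDisk :=
    (hh.continuousOn.add (Complex.continuous_conj.comp_continuousOn hg.continuousOn)).congr hf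
  have hAc : ContinuousOn (fun z => diskDeriv f z z) openUnitDisk := by
    refine ContinuousOn.congr (f := fun z => deriv h z * z + (starRingEnd ℂ) (deriv g z * z)) ?_
      fun z hz => diskDeriv_eq_of_decomposition hh hg hf hz z
    exact (hh.deriv.continuousOn.mul continuousOn_id).add
      (Complex.continuous_conj.comp_continuousOn (hg.deriv.continuousOn.mul continuousOn_id))
  have hHc : ContinuousOn (fun z => hsNormSq (diskDeriv f z)) openUnitDisk := by
    refine ContinuousOn.congr ?_ fun z hz => hsNormSq_eq_of_decomposition hh hg hf hz
    exact continuousOn_const.mul ((hh.deriv.continuousOn.norm.pow 2).add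
      (hg.deriv.continuousOn.norm.pow 2))
  have hcm : Continuous fun p : ℝ × ℝ => circleMap 0 p.1 p.2 := by
    simp only [circleMap_zero]; fun_prop
  have hmaps : Set.MapsTo (fun p : ℝ × ℝ => circleMap 0 p.1 p.2) (Set.Ioo 0 1 ×ˢ Set.univ)
      openUnitDisk := fun p hp => circleMap_mem_openUnitDisk hp.1.1.le hp.1.2 _
  have hDc : ContinuousOn (fun p : ℝ × ℝ =>
      radialFluxDeriv f h g (circleMap 0 p.1 p.2) (circleMap 0 1 p.2))
      (Set.Ioo 0 1 ×ˢ Set.univ) := by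
    have k0 := hfc.comp hcm.continuousOn hmaps
    have k1 := hh.deriv.continuousOn.comp hcm.continuousOn hmaps
    have k2 := hg.deriv.continuousOn.comp hcm.continuousOn hmaps
    have k3 := hh.deriv.deriv.continuousOn.comp hcm.continuousOn hmaps
    have k4 := hg.deriv.deriv.continuousOn.comp hcm.continuousOn hmaps
    have k5 : ContinuousOn (fun p : ℝ × ℝ => circleMap 0 1 p.2) (Set.Ioo 0 1 ×ˢ Set.univ) :=
      ((continuous_circleMap 0 1).comp continuous_snd).continuousOn
    have kc : ∀ {F : ℝ × ℝ → ℂ} {s : Set (ℝ × ℝ)}, ContinuousOn F s →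
        ContinuousOn (fun p => (starRingEnd ℂ) (F p)) s := fun h =>
      Complex.continuous_conj.comp_continuousOn h
    have kz := hcm.continuousOn (s := Set.Ioo (0 : ℝ) 1 ×ˢ Set.univ)
    exact Complex.continuous_re.comp_continuousOn
      (((kc ((k1.mul k5).add (kc (k2.mul k5)))).mul ((kz.mul k1).add (kc (kz.mul k2)))).add
        ((kc k0).mul ((k5.mul (k1.add (kz.mul k3))).add (kc (k5.mul (k2.add (kz.mul k4)))))))
  have hslice : ∀ {F : ℂ → ℝ}, ContinuousOn F openUnitDisk → ∀ s ∈ Set.Ioo (0 : ℝ) 1,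
      Continuous fun t => F (circleMap 0 s t) := fun hF s hs =>
    hF.comp_continuous (continuous_circleMap 0 s)
      fun t => circleMap_mem_openUnitDisk hs.1.le hs.2 t
  have hEc : ContinuousOn (fun z => ((starRingEnd ℂ) (f z) * diskDeriv f z z).re) openUnitDisk :=
    Complex.continuous_re.comp_continuousOn
      ((Complex.continuous_conj.comp_continuousOn hfc).mul hAc)
  obtain ⟨ε, hε, hball⟩ := Metric.nhds_basis_closedBall.mem_iff.1 (Ioo_mem_nhds hr.1 hr.2)
  obtain ⟨C, hC⟩ := ((isCompact_closedBall r ε).prod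
    (isCompact_uIcc (a := (0 : ℝ)) (b := 2 * Real.pi))).exists_bound_of_continuousOn
    (hDc.mono (Set.prod_mono hball (Set.subset_univ _)))
  have hDr : Continuous fun t => radialFluxDeriv f h g (circleMap 0 r t) (circleMap 0 1 t) :=
    hDc.comp_continuous (f := fun t : ℝ => (r, t)) (by fun_prop) fun t => ⟨hr, Set.mem_univ _⟩
  have hmain := (intervalIntegral.hasDerivAt_integral_of_dominated_loc_of_deriv_le
    (μ := volume) (a := 0) (b := 2 * Real.pi) (bound := fun _ => C)
    (F := fun r t => ((starRingEnd ℂ) (f (circleMap 0 r t)) *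
      diskDeriv f (circleMap 0 r t) (circleMap 0 r t)).re)
    (F' := fun r t => radialFluxDeriv f h g (circleMap 0 r t) (circleMap 0 1 t))
    (Metric.closedBall_mem_nhds r hε)
    (by
      filter_upwards [Ioo_mem_nhds hr.1 hr.2] with s hs
      exact (hslice hEc s hs).aestronglyMeasurable)
    ((hslice hEc r hr).intervalIntegrable _ _)
    hDr.aestronglyMeasurable
    (Filter.Eventually.of_forall fun t ht x hx => hC (x, t) ⟨hx, Set.uIoc_subset_uIcc ht⟩)
    intervalIntegrable_const
    (Filter.Eventually.of_forall fun t _ x hx => hasDerivAt_radialFlux hh hg hf (hball hx) t)).2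
  have hint : ∫ t in (0 : ℝ)..2 * Real.pi,
      (r * radialFluxDeriv f h g (circleMap 0 r t) (circleMap 0 1 t)
        - r ^ 2 * hsNormSq (diskDeriv f (circleMap 0 r t))) = 0 := by
    have hHr := hslice hHc r hr
    rw [intervalIntegral.integral_eq_sub_of_hasDerivAt
      (fun t _ => hasDerivAt_tangentialFlux hh hg hf hr t)
      (((continuous_const.mul hDr).sub (continuous_const.mul hHr)).intervalIntegrable _ _)]
    have : circleMap 0 r (2 * Real.pi) = circleMap 0 r 0 := by
      simpa using periodic_circleMap 0 r 0
    rw [this, sub_self]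
  have i1 : IntervalIntegrable (fun t => r * radialFluxDeriv f h g (circleMap 0 r t)
      (circleMap 0 1 t)) volume 0 (2 * Real.pi) :=
    (continuous_const.mul hDr).intervalIntegrable _ _
  have i2 : IntervalIntegrable (fun t => r ^ 2 * hsNormSq (diskDeriv f (circleMap 0 r t))) volume 0
      (2 * Real.pi) := (continuous_const.mul (hslice hHc r hr)).intervalIntegrable _ _
  rw [intervalIntegral.integral_sub i1 i2,
    intervalIntegral.integral_const_mul, intervalIntegral.integral_const_mul] at hint
  simp only [Real.circleAverage]
  refine (hmain.const_smul (2 * Real.pi)⁻¹).congr_deriv ?_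
  simp only [smul_eq_mul]
  have hr0 := hr.1.ne'
  have : (∫ t in (0 : ℝ)..2 * Real.pi, radialFluxDeriv f h g (circleMap 0 r t) (circleMap 0 1 t))
      = r * ∫ t in (0 : ℝ)..2 * Real.pi, hsNormSq (diskDeriv f (circleMap 0 r t)) := by
    apply mul_left_cancel₀ hr0
    linarith
  rw [this]; ring

end Decomposition

/-- The Dirichlet energy is the boundary flux of `|f| ^ 2 / 2`. -/
theorem diskEnergy_eq_circleAverage {f : ℂ → ℂ}
    (hharm : InnerProductSpace.HarmonicOnNhd f openUnitDisk)
    (hC1 : ContDiffOn ℝ 1 f closedUnitDisk) :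
    diskEnergy f = 2 * Real.pi *
      Real.circleAverage (fun z => ((starRingEnd ℂ) (f z) * diskDeriv f z z).re) 0 1 := by
  obtain ⟨h, g, hh, hg, hf⟩ := exists_analytic_add_conj hharm
  have hc := continuousOn_hsNormSq_diskDeriv hC1
  have hEc : ContinuousOn (fun z => ((starRingEnd ℂ) (f z) * diskDeriv f z z).re) closedUnitDisk :=
    Complex.continuous_re.comp_continuousOn
      ((Complex.continuous_conj.comp_continuousOn hC1.continuousOn).mul
        ((continuousOn_diskDeriv hC1).clm_apply continuousOn_id))
  have hset : {z : ℂ | ‖z - 0‖ ∈ Set.Icc (0 : ℝ) 1} = closedUnitDisk := by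
    ext z; simp [closedUnitDisk]
  have hav : ∀ {F : ℂ → ℝ}, ContinuousOn F closedUnitDisk →
      ContinuousOn (Real.circleAverage F 0) (Set.Icc 0 1) := fun hF =>
    Real.ContinuousOn.circleAverage (by rw [hset]; exact hF) fun r hr => hr.1
  rw [diskEnergy, setIntegral_openUnitDisk_eq_polar hc,
    intervalIntegral.integral_eq_sub_of_hasDerivAt_of_le zero_le_one (hav hEc)
      (fun r hr => hasDerivAt_circleAverage_radialFlux hh hg hf hr)
      ((continuousOn_id.mul (hav hc)).intervalIntegrable_of_Icc zero_le_one)]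
  simp

/-- A complex-valued harmonic function is determined by its boundary values. -/
theorem eqOn_openUnitDisk_of_eqOn_sphere {f₁ f₂ : ℂ → ℂ}
    (h₁ : InnerProductSpace.HarmonicContOnCl f₁ openUnitDisk)
    (h₂ : InnerProductSpace.HarmonicContOnCl f₂ openUnitDisk)
    (h : Set.EqOn f₁ f₂ (Metric.sphere 0 1)) : Set.EqOn f₁ f₂ openUnitDisk := by
  have key : ∀ (l : ℂ →L[ℝ] ℝ), ∀ w ∈ openUnitDisk, l (f₁ w) = l (f₂ w) := by
    intro l w hw
    have e1 := (h₁.comp_CLM l).circleAverage_poissonKernel_smul hw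
    have e2 := (h₂.comp_CLM l).circleAverage_poissonKernel_smul hw
    simp only [Function.comp_apply] at e1 e2
    rw [← e1, ← e2]
    refine Real.circleAverage_congr_sphere fun z hz => ?_
    rw [abs_one] at hz
    simp [h hz]
  intro w hw
  exact Complex.ext (key Complex.reCLM w hw) (key Complex.imCLM w hw)

/-- The chord quotient kernel of a map of the circle. -/
noncomputable def chordKernel (f : ℂ → ℂ) (z w : ℂ) : ℝ := ‖f z - f w‖ ^ 2 / ‖z - w‖ ^ 2

open Filter Topology MeasureTheory in
/-- The normal derivative of `|f| ^ 2 / 2` at a boundary point, as an average of squared chord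
quotients. -/
theorem radialFlux_eq_circleAverage_chordKernel {f : ℂ → ℂ}
    (hharm : InnerProductSpace.HarmonicOnNhd f openUnitDisk)
    (hC1 : ContDiffOn ℝ 1 f closedUnitDisk)
    (hs : Set.MapsTo f (Metric.sphere 0 1) (Metric.sphere 0 1)) {ζ : ℂ}
    (hζ : ζ ∈ Metric.sphere (0 : ℂ) 1) :
    ((starRingEnd ℂ) (f ζ) * diskDeriv f ζ ζ).re
      = Real.circleAverage (fun z => chordKernel f z ζ) 0 1 := by
  have hζ1 : ‖ζ‖ = 1 := by simpa using hζ
  have hfζ : ‖f ζ‖ = 1 := by simpa using hs hζ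
  have hζd : ζ ∈ closedUnitDisk := Metric.sphere_subset_closedBall hζ
  set l : ℂ →L[ℝ] ℝ := Complex.reCLM.comp
    ((ContinuousLinearMap.mul ℝ ℂ) ((starRingEnd ℂ) (f ζ))) with hl
  have hlv : ∀ w, l w = ((starRingEnd ℂ) (f ζ) * w).re := fun w => by simp [hl]
  have hcl : InnerProductSpace.HarmonicContOnCl f openUnitDisk :=
    ⟨hharm, by rw [closure_openUnitDisk]; exact hC1.continuousOn⟩
  have hv : InnerProductSpace.HarmonicContOnCl ((fun _ => (1 : ℝ)) - l ∘ f) openUnitDisk :=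
    (hcl.comp_CLM l).const_sub 1
  set v : ℂ → ℝ := (fun _ => (1 : ℝ)) - l ∘ f with hvdef
  have hvs : ∀ z ∈ Metric.sphere (0 : ℂ) 1, v z = ‖f z - f ζ‖ ^ 2 / 2 := by
    intro z hz
    have hfz : ‖f z‖ = 1 := by simpa using hs hz
    simp only [hvdef, Pi.sub_apply, Function.comp_apply, hlv]
    rw [Complex.sq_norm, Complex.normSq_sub, Complex.normSq_eq_norm_sq,
      Complex.normSq_eq_norm_sq, hfz, hfζ, mul_comm (f z)]
    ring
  have hvζ : v ζ = 0 := by rw [hvs ζ hζ]; simp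
  have hmem : ∀ r ∈ Set.Ioo (0 : ℝ) 1, (r : ℂ) * ζ ∈ openUnitDisk := fun r hr => by
    simp [openUnitDisk, hζ1, abs_of_pos hr.1, hr.2]
  -- the left-hand side as a limit
  have hL : Tendsto (fun r : ℝ => v (r * ζ) / (1 - r)) (𝓝[Set.Ioo 0 1] 1)
      (𝓝 ((starRingEnd ℂ) (f ζ) * diskDeriv f ζ ζ).re) := by
    have h1 : HasFDerivWithinAt f (diskDeriv f ζ) closedUnitDisk (((1 : ℝ) : ℂ) * ζ) := by
      simpa using hasFDerivWithinAt_diskDeriv hC1 hζd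
    have h0 : HasDerivWithinAt (fun r : ℝ => (r : ℂ) * ζ) ζ (Set.Ioo 0 1) 1 := by
      simpa using ((hasDerivAt_id (1 : ℝ)).ofReal_comp.mul_const ζ).hasDerivWithinAt
    have h2 := h1.comp_hasDerivWithinAt 1 h0 fun r hr => openUnitDisk_subset (hmem r hr)
    have h3 := (l.hasFDerivAt.comp_hasDerivWithinAt 1 h2).const_sub 1
    have h4 := (hasDerivWithinAt_iff_tendsto_slope' (by simp)).1 h3
    have h5 := h4.neg
    rw [neg_neg, hlv] at h5
    refine h5.congr fun r => ?_
    have : v (((1 : ℝ) : ℂ) * ζ) = 0 := by simpa using hvζ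
    simp only [slope_def_field, Function.comp_apply]
    change -((v (r * ζ) - v (((1 : ℝ) : ℂ) * ζ)) / (r - 1)) = _
    rw [this, sub_zero, ← neg_sub 1 r, div_neg, neg_neg]
  -- the Poisson formula at an interior point
  have hP : ∀ r ∈ Set.Ioo (0 : ℝ) 1, v (r * ζ) / (1 - r) = (2 * Real.pi)⁻¹ *
      ∫ t in (0 : ℝ)..2 * Real.pi, (1 + r) / 2 *
        (‖f (circleMap 0 1 t) - f ζ‖ ^ 2 / ‖circleMap 0 1 t - r * ζ‖ ^ 2) := by
    intro r hr
    have h1 := hv.circleAverage_poissonKernel_smul (hmem r hr)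
    rw [← h1, Real.circleAverage, smul_eq_mul, mul_div_assoc, ← intervalIntegral.integral_div]
    congr 1
    refine intervalIntegral.integral_congr fun t _ => ?_
    rw [Pi.smul_apply', smul_eq_mul, hvs _ (circleMap_mem_sphere 0 zero_le_one t), poissonKernel]
    have hr1 : 1 - r ≠ 0 := by linarith [hr.2]
    simp only [sub_zero, norm_circleMap_one, norm_mul, Complex.norm_real, hζ1, mul_one,
      Real.norm_eq_abs, sq_abs]
    field_simp
    ring
  obtain ⟨C, hC⟩ := exists_lipschitzOnWith hC1
  have hR : Tendsto (fun r : ℝ => (2 * Real.pi)⁻¹ *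
      ∫ t in (0 : ℝ)..2 * Real.pi, (1 + r) / 2 *
        (‖f (circleMap 0 1 t) - f ζ‖ ^ 2 / ‖circleMap 0 1 t - r * ζ‖ ^ 2)) (𝓝[Set.Ioo 0 1] 1)
      (𝓝 (Real.circleAverage (fun z => chordKernel f z ζ) 0 1)) := by
    rw [Real.circleAverage, smul_eq_mul]
    refine Tendsto.const_mul _ ?_
    have hgap : ∀ r ∈ Set.Ioo (0 : ℝ) 1, ∀ t, 1 - r ≤ ‖circleMap 0 1 t - r * ζ‖ := by
      intro r hr t
      have := norm_sub_norm_le (circleMap 0 1 t) (r * ζ)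
      rwa [norm_circleMap_one, norm_mul, Complex.norm_real, hζ1, mul_one, Real.norm_eq_abs,
        abs_of_pos hr.1] at this
    refine intervalIntegral.tendsto_integral_filter_of_dominated_convergence
      (fun _ => (4 * C ^ 2 : ℝ)) ?_ ?_ intervalIntegrable_const ?_
    · filter_upwards [self_mem_nhdsWithin] with r hr
      have hc1 : Continuous fun t => f (circleMap 0 1 t) :=
        hC1.continuousOn.comp_continuous (continuous_circleMap 0 1)
          fun t => circleMap_mem_closedUnitDisk zero_le_one le_rfl t
      refine Continuous.aestronglyMeasurable (continuous_const.mul (Continuous.div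
        ((hc1.sub continuous_const).norm.pow 2) (by fun_prop) fun t => ?_))
      have := hgap r hr t
      have h2 : 0 < ‖circleMap 0 1 t - r * ζ‖ := by linarith [hr.2]
      positivity
    · filter_upwards [self_mem_nhdsWithin] with r hr
      refine Eventually.of_forall fun t _ => ?_
      have h1 := hgap r hr t
      have h2 : 0 < ‖circleMap 0 1 t - r * ζ‖ := by linarith [hr.2]
      have h3 : ‖circleMap 0 1 t - ζ‖ ≤ 2 * ‖circleMap 0 1 t - r * ζ‖ := by
        have e : circleMap 0 1 t - ζ = (circleMap 0 1 t - r * ζ) - ((1 - r : ℝ) : ℂ) * ζ := by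
          push_cast; ring
        rw [e]
        refine (norm_sub_le _ _).trans ?_
        rw [norm_mul, Complex.norm_real, hζ1, Real.norm_eq_abs, abs_of_pos (by linarith [hr.2])]
        linarith
      have h4 : ‖f (circleMap 0 1 t) - f ζ‖ ≤ C * ‖circleMap 0 1 t - ζ‖ := by
        simpa [dist_eq_norm] using hC.dist_le_mul _
          (circleMap_mem_closedUnitDisk zero_le_one le_rfl t) _ hζd
      have h5 : ‖f (circleMap 0 1 t) - f ζ‖ ≤ 2 * C * ‖circleMap 0 1 t - r * ζ‖ := by
        have := mul_le_mul_of_nonneg_left h3 C.coe_nonneg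
        linarith
      have h6 : ‖f (circleMap 0 1 t) - f ζ‖ ^ 2 / ‖circleMap 0 1 t - r * ζ‖ ^ 2
          ≤ 4 * C ^ 2 := by
        rw [div_le_iff₀ (by positivity)]
        calc _ ≤ (2 * C * ‖circleMap 0 1 t - r * ζ‖) ^ 2 := by gcongr
          _ = _ := by ring
      have hr0 := hr.1
      rw [Real.norm_of_nonneg (by positivity)]
      calc _ ≤ (1 : ℝ) * (4 * C ^ 2) := by
            refine mul_le_mul (by linarith [hr.2]) h6 (by positivity) zero_le_one
        _ = _ := one_mul _
    · refine Eventually.of_forall fun t _ => ?_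
      rcases eq_or_ne (circleMap 0 1 t) ζ with h | h
      · simp only [h, chordKernel, sub_self, norm_zero]
        norm_num
      · have h0 : ‖circleMap 0 1 t - ((1 : ℝ) : ℂ) * ζ‖ ^ 2 ≠ 0 := by
          rw [Complex.ofReal_one, one_mul]
          exact pow_ne_zero 2 (norm_ne_zero_iff.2 (sub_ne_zero.2 h))
        have hcont : ContinuousAt (fun r : ℝ => (1 + r) / 2 *
            (‖f (circleMap 0 1 t) - f ζ‖ ^ 2 / ‖circleMap 0 1 t - r * ζ‖ ^ 2)) 1 :=
          ContinuousAt.mul (by fun_prop) (ContinuousAt.div (by fun_prop) (by fun_prop) h0)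
        have := hcont.tendsto.mono_left (nhdsWithin_le_nhds (s := Set.Ioo 0 1))
        refine this.trans (le_of_eq ?_)
        simp [chordKernel]
  have hne : (𝓝[Set.Ioo 0 1] (1 : ℝ)).NeBot := by
    rw [nhdsWithin_Ioo_eq_nhdsLT zero_lt_one]; infer_instance
  refine tendsto_nhds_unique hL (hR.congr' ?_)
  filter_upwards [self_mem_nhdsWithin] with r hr
  exact (hP r hr).symm

theorem sq_norm_circleMap_sub (a b : ℝ) :
    ‖circleMap 0 1 a - circleMap 0 1 b‖ ^ 2 = 4 * Real.sin ((a - b) / 2) ^ 2 := by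
  rw [Complex.sq_norm, Complex.normSq_apply]
  simp only [Complex.sub_re, Complex.sub_im, circleMap_zero_re, circleMap_zero_im, one_mul]
  have h1 : Real.sin ((a - b) / 2) ^ 2 = 1 / 2 - Real.cos (a - b) / 2 := by
    rw [Real.sin_sq_eq_half_sub, mul_div_cancel₀ _ two_ne_zero]
  rw [h1, Real.cos_sub]
  nlinarith [Real.sin_sq_add_cos_sq a, Real.sin_sq_add_cos_sq b]

/-- The squared chord quotient of the circle map with argument `ψ`. -/
noncomputable def argKernel (ψ : ℝ → ℝ) (s t : ℝ) : ℝ :=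
  Real.sin ((ψ s - ψ t) / 2) ^ 2 / Real.sin ((s - t) / 2) ^ 2

section Kernel
variable {ψ ψ' : ℝ → ℝ}

theorem argKernel_eq_chord_quotient (s t : ℝ) : argKernel ψ s t =
    ‖circleMap 0 1 (ψ s) - circleMap 0 1 (ψ t)‖ ^ 2 / ‖circleMap 0 1 s - circleMap 0 1 t‖ ^ 2 := by
  rw [sq_norm_circleMap_sub, sq_norm_circleMap_sub, argKernel,
    mul_div_mul_left _ _ four_ne_zero]

theorem argKernel_nonneg (s t : ℝ) : 0 ≤ argKernel ψ s t := by unfold argKernel; positivity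

theorem measurable_argKernel (hψ : Continuous ψ) :
    Measurable (Function.uncurry (argKernel ψ)) := by
  have h := hψ.measurable
  unfold argKernel Function.uncurry
  fun_prop

theorem intervalIntegrable_mul_argKernel (hψ : Continuous ψ) (hψ' : Continuous ψ') {M : ℝ}
    (hM : ∀ s t, argKernel ψ s t ≤ M) (s a b : ℝ) :
    IntervalIntegrable (fun t => (ψ' t - 1) * argKernel ψ s t) MeasureTheory.volume a b := by
  have hk : IntervalIntegrable (argKernel ψ s) MeasureTheory.volume a b := by
    refine (intervalIntegrable_const (c := M)).mono_fun
      ((measurable_argKernel hψ).of_uncurry_left.aestronglyMeasurable)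
      (Filter.Eventually.of_forall fun t => ?_)
    beta_reduce
    rw [Real.norm_of_nonneg (argKernel_nonneg s t)]
    exact (hM s t).trans (Real.le_norm_self M)
  exact hk.continuousOn_mul (hψ'.sub continuous_const).continuousOn

theorem integral_mul_argKernel_nonneg (hψ : ∀ t, HasDerivAt ψ (ψ' t) t) (hψ' : Continuous ψ')
    (hpos : ∀ t, 0 ≤ ψ' t) (hper : ∀ t, ψ (t + 2 * Real.pi) = ψ t + 2 * Real.pi) {M : ℝ}
    (hM : ∀ s t, argKernel ψ s t ≤ M) (s : ℝ) :
    0 ≤ ∫ t in (0 : ℝ)..2 * Real.pi, (ψ' t - 1) * argKernel ψ s t ∧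
    ((∫ t in (0 : ℝ)..2 * Real.pi, (ψ' t - 1) * argKernel ψ s t) = 0 →
      ∀ t, ψ t = t + (ψ s - s)) := by
  have hψc : Continuous ψ := continuous_iff_continuousAt.2 fun t => (hψ t).continuousAt
  have hdper : ∀ t, ψ' (t + 2 * Real.pi) = ψ' t := fun t => by
    have h2 := (hψ (t + 2 * Real.pi)).comp_add_const t (2 * Real.pi)
    simp only [hper] at h2
    exact h2.unique ((hψ t).add_const _)
  have hp : Function.Periodic (fun t => (ψ' t - 1) * argKernel ψ s t) (2 * Real.pi) := fun t => by
    beta_reduce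
    rw [argKernel_eq_chord_quotient, argKernel_eq_chord_quotient, hdper, hper,
      periodic_circleMap, periodic_circleMap]
  have hk : ∀ a, argKernel ψ s (s + 2 * a)
      = Real.sin ((ψ (s + 2 * a) - ψ s) / 2) ^ 2 / Real.sin a ^ 2 := fun a => by
    rw [argKernel, show (ψ s - ψ (s + 2 * a)) / 2 = -((ψ (s + 2 * a) - ψ s) / 2) by ring,
      show (s - (s + 2 * a)) / 2 = -a by ring, Real.sin_neg, Real.sin_neg, neg_sq, neg_sq]
  have hsub : ∫ t in (0 : ℝ)..2 * Real.pi, (ψ' t - 1) * argKernel ψ s t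
      = 2 * ∫ a in (0 : ℝ)..Real.pi, (ψ' (s + 2 * a) - 1) *
        (Real.sin ((ψ (s + 2 * a) - ψ s) / 2) ^ 2 / Real.sin a ^ 2) := by
    have h1 := hp.intervalIntegral_add_eq 0 s
    have h2 := intervalIntegral.integral_comp_add_mul (a := 0) (b := Real.pi)
      (fun t => (ψ' t - 1) * argKernel ψ s t) two_ne_zero s
    simp only [hk] at h2
    rw [zero_add] at h1
    rw [h1, h2, mul_zero, add_zero, smul_eq_mul]
    ring
  have hb : ∀ a, HasDerivAt (fun a => (ψ (s + 2 * a) - ψ s) / 2) (ψ' (s + 2 * a)) a := fun a => by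
    have h1 : HasDerivAt (fun a : ℝ => s + 2 * a) 2 a := by
      simpa using ((hasDerivAt_id a).const_mul 2).const_add s
    exact ((((hψ _).comp a h1).sub_const (ψ s)).div_const 2).congr_deriv (by ring)
  have hint : IntervalIntegrable (fun a => (ψ' (s + 2 * a) - 1) *
      (Real.sin ((ψ (s + 2 * a) - ψ s) / 2) ^ 2 / Real.sin a ^ 2)) MeasureTheory.volume 0
      Real.pi := by
    have h1 := (intervalIntegrable_mul_argKernel hψc hψ' hM s s (s + 2 * Real.pi)).comp_add_left s
    have h2 := h1.comp_mul_left (c := 2)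
    simp only [hk] at h2
    simpa using h2
  obtain ⟨r1, r2⟩ := arc_integral_nonneg hb (by fun_prop) (fun a => hpos _) (by simp)
    (by rw [hper]; ring) hint
  refine ⟨by rw [hsub]; linarith, fun h0 => ?_⟩
  have h3 := r2 (by rw [hsub] at h0; linarith)
  have hq : Function.Periodic (fun t => ψ t - t) (2 * Real.pi) := fun t => by
    beta_reduce; rw [hper]; ring
  intro t
  obtain ⟨y, hy, hye⟩ := hq.exists_mem_Ico (by positivity : (0 : ℝ) < 2 * Real.pi) t s
  have h4 := h3 ((y - s) / 2) ⟨by linarith [hy.1], by linarith [hy.2]⟩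
  rw [show s + 2 * ((y - s) / 2) = y by ring] at h4
  linarith

open MeasureTheory in
theorem integral_mul_integral_argKernel_nonneg (hψ : ∀ t, HasDerivAt ψ (ψ' t) t)
    (hψ' : Continuous ψ') (hpos : ∀ t, 0 ≤ ψ' t)
    (hper : ∀ t, ψ (t + 2 * Real.pi) = ψ t + 2 * Real.pi) {M : ℝ}
    (hM : ∀ s t, argKernel ψ s t ≤ M) :
    0 ≤ ∫ t in (0 : ℝ)..2 * Real.pi,
      (ψ' t - 1) * ∫ s in (0 : ℝ)..2 * Real.pi, argKernel ψ s t ∧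
    ((∫ t in (0 : ℝ)..2 * Real.pi,
      (ψ' t - 1) * ∫ s in (0 : ℝ)..2 * Real.pi, argKernel ψ s t) = 0 →
      ∃ c, ∀ t, ψ t = t + c) := by
  have hψc : Continuous ψ := continuous_iff_continuousAt.2 fun t => (hψ t).continuousAt
  have hpi : (0 : ℝ) ≤ 2 * Real.pi := by positivity
  have hint : IntegrableOn (Function.uncurry fun s t => (ψ' t - 1) * argKernel ψ s t)
      (Set.uIoc 0 (2 * Real.pi) ×ˢ Set.uIoc 0 (2 * Real.pi)) volume := by
    have hkint : IntegrableOn (Function.uncurry (argKernel ψ))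
        (Set.Icc 0 (2 * Real.pi) ×ˢ Set.Icc 0 (2 * Real.pi)) volume := by
      refine Measure.integrableOn_of_bounded (M := M)
        (isCompact_Icc.prod isCompact_Icc).measure_lt_top.ne
        (measurable_argKernel hψc).aestronglyMeasurable
        (Filter.Eventually.of_forall fun p => ?_)
      rw [Function.uncurry, Real.norm_of_nonneg (argKernel_nonneg _ _)]
      exact hM _ _
    have hc : Continuous fun p : ℝ × ℝ => ψ' p.2 - 1 := by fun_prop
    have := hkint.continuousOn_mul hc.continuousOn (isCompact_Icc.prod isCompact_Icc)
    rw [Set.uIoc_of_le hpi]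
    exact this.mono_set (Set.prod_mono Set.Ioc_subset_Icc_self Set.Ioc_subset_Icc_self)
  have hswap : (∫ t in (0 : ℝ)..2 * Real.pi,
      (ψ' t - 1) * ∫ s in (0 : ℝ)..2 * Real.pi, argKernel ψ s t)
      = ∫ s in (0 : ℝ)..2 * Real.pi, ∫ t in (0 : ℝ)..2 * Real.pi, (ψ' t - 1) * argKernel ψ s t := by
    rw [intervalIntegral_intervalIntegral_swap hint]
    simp only [intervalIntegral.integral_const_mul]
  have key := integral_mul_argKernel_nonneg hψ hψ' hpos hper hM
  rw [hswap]
  refine ⟨intervalIntegral.integral_nonneg hpi fun s _ => (key s).1, fun h0 => ?_⟩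
  have hJ : IntegrableOn (fun s => ∫ t in (0 : ℝ)..2 * Real.pi, (ψ' t - 1) * argKernel ψ s t)
      (Set.Ioc 0 (2 * Real.pi)) := by
    rw [Set.uIoc_of_le hpi, IntegrableOn, Measure.volume_eq_prod,
      ← Measure.prod_restrict] at hint
    have := hint.integral_prod_left
    simpa only [intervalIntegral.integral_of_le hpi, Function.uncurry] using! this
  rw [intervalIntegral.integral_of_le hpi, setIntegral_eq_zero_iff_of_nonneg_ae
    (Filter.Eventually.of_forall fun s => (key s).1) hJ] at h0
  have hne : (ae (volume.restrict (Set.Ioc (0 : ℝ) (2 * Real.pi)))).NeBot := by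
    rw [ae_neBot, Ne, Measure.restrict_eq_zero, Real.volume_Ioc]
    simp [Real.pi_pos]
  obtain ⟨s, hs⟩ := h0.exists
  exact ⟨ψ s - s, (key s).2 hs⟩

end Kernel

open Filter Topology in
theorem norm_deriv_boundary_eq_one_of_isometry {f : ℂ → ℂ} {γ' : ℂ} {t : ℝ}
    (hiso : Isometry (closedUnitDisk.domRestrict f))
    (hγ : HasDerivAt (fun t => f (circleMap 0 1 t)) γ' t) : ‖γ'‖ = 1 := by
  have h1 := (hasDerivAt_iff_tendsto_slope.1 hγ).norm
  have h2 := (hasDerivAt_iff_tendsto_slope.1 (hasDerivAt_circleMap 0 1 t)).norm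
  rw [norm_mul, norm_circleMap_one, Complex.norm_I, mul_one] at h2
  refine tendsto_nhds_unique h1 (h2.congr fun s => ?_)
  have hm := fun s => circleMap_mem_closedUnitDisk zero_le_one le_rfl s
  have h3 := hiso.dist_eq ⟨_, hm s⟩ ⟨_, hm t⟩
  simp only [Set.domRestrict_apply, Subtype.dist_eq, dist_eq_norm] at h3
  rw [slope_def_module, slope_def_module, norm_smul, norm_smul, h3]

theorem isometry_of_boundary_rotation {f : ℂ → ℂ}
    (hharm : InnerProductSpace.HarmonicOnNhd f openUnitDisk)
    (hc : ContinuousOn f closedUnitDisk) {ψ : ℝ → ℝ} {c : ℝ} (hψ : ∀ t, ψ t = t + c)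
    (h : (∀ t, f (circleMap 0 1 t) = circleMap 0 1 (ψ t)) ∨
      ∀ t, f (circleMap 0 1 t) = (starRingEnd ℂ) (circleMap 0 1 (ψ t))) :
    Isometry (closedUnitDisk.domRestrict f) := by
  have hcl : InnerProductSpace.HarmonicContOnCl f openUnitDisk :=
    ⟨hharm, by rwa [closure_openUnitDisk]⟩
  have hrot : ∀ t, circleMap 0 1 (ψ t) = circleMap 0 1 c * circleMap 0 1 t := fun t => by
    rw [hψ, circleMap_zero_mul, mul_one, add_comm]
  have hlin : InnerProductSpace.HarmonicContOnCl (fun z => circleMap 0 1 c * z) openUnitDisk :=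
    ⟨fun z _ => (analyticAt_const.mul analyticAt_id).harmonicAt, by fun_prop⟩
  have key : ∀ F : ℂ → ℂ, InnerProductSpace.HarmonicContOnCl F openUnitDisk →
      (∀ t, f (circleMap 0 1 t) = F (circleMap 0 1 t)) → (∀ x y, ‖F x - F y‖ = ‖x - y‖) →
      Isometry (closedUnitDisk.domRestrict f) := by
    intro F hF hb hn
    have hs : Set.EqOn f F (Metric.sphere 0 1) := fun z hz => by
      obtain ⟨t, rfl⟩ := exists_circleMap_one_eq (z := z) (by simpa using hz)
      exact hb t
    have hd := eqOn_openUnitDisk_of_eqOn_sphere hcl hF hs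
    have hall : ∀ z ∈ closedUnitDisk, f z = F z := fun z hz => by
      rw [closedUnitDisk, ← Metric.ball_union_sphere] at hz
      exact hz.elim (fun h => hd h) fun h => hs h
    refine Isometry.of_dist_eq fun x y => ?_
    rw [Set.domRestrict_apply, Set.domRestrict_apply, hall _ x.2, hall _ y.2, dist_eq_norm, hn,
      Subtype.dist_eq, dist_eq_norm]
  have hmul : ∀ x y : ℂ, ‖circleMap 0 1 c * x - circleMap 0 1 c * y‖ = ‖x - y‖ := fun x y => by
    rw [← mul_sub, norm_mul, norm_circleMap_one, one_mul]
  rcases h with h | h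
  · exact key _ hlin (fun t => by rw [h, hrot]) hmul
  · refine key (fun z => (starRingEnd ℂ) (circleMap 0 1 c * z))
      (hlin.comp_CLM (Complex.conjCLE : ℂ →L[ℝ] ℂ)) (fun t => by rw [h, hrot]) fun x y => ?_
    rw [← map_sub, Complex.norm_conj, hmul]

theorem theorem1p6 (f : ℂ → ℂ)
    (hhomeo : IsHomeomorphOnto f closedUnitDisk closedUnitDisk)
    (hharm : InnerProductSpace.HarmonicOnNhd f openUnitDisk)
    (hC1 : ContDiffOn ℝ 1 f closedUnitDisk) :
    diskEnergy f ≤ boundaryJacobian f ∧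
    2 * diskJacobian f ≤ diskEnergy f ∧
    2 * diskJacobian f = 2 * Real.pi ∧
    (diskEnergy f < boundaryJacobian f ↔ ¬ Isometry (closedUnitDisk.domRestrict f)) := by
  have hs := mapsTo_sphere hhomeo hharm
  have hmem : ∀ t, circleMap 0 1 t ∈ closedUnitDisk :=
    fun t => circleMap_mem_closedUnitDisk zero_le_one le_rfl t
  have hsph : ∀ t, circleMap 0 1 t ∈ Metric.sphere (0 : ℂ) 1 :=
    fun t => circleMap_mem_sphere 0 zero_le_one t
  have hγ := hasDerivAt_boundary hC1
  have hAc := (continuousOn_diskDeriv hC1).comp_continuous (continuous_circleMap 0 1) hmem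
  have hcm := continuous_circleMap 0 1
  obtain ⟨ψ, ψ', hψ, hψ', hpos, hper, hform, σ, hσ, hder⟩ := exists_monotone_arg hγ
    (hAc.clm_apply (hcm.mul continuous_const)) (fun t => by simpa using hs (hsph t))
    (fun s t => ⟨fun h => hhomeo.1.injOn (hmem s) (hmem t) h, fun h => by rw [h]⟩)
  have hker : ∀ s t, chordKernel f (circleMap 0 1 s) (circleMap 0 1 t) = argKernel ψ s t := by
    intro s t
    rw [chordKernel, argKernel_eq_chord_quotient]
    rcases hform with h | h
    · rw [h, h]
    · rw [h, h, ← map_sub, Complex.norm_conj]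
  obtain ⟨C, hC⟩ := exists_lipschitzOnWith hC1
  have hM : ∀ s t, argKernel ψ s t ≤ (C : ℝ) ^ 2 := by
    intro s t
    rw [← hker, chordKernel]
    refine div_le_of_le_mul₀ (by positivity) (by positivity) ?_
    rw [← mul_pow]
    gcongr
    simpa [dist_eq_norm] using hC.dist_le_mul _ (hmem s) _ (hmem t)
  set u : ℝ → ℝ := fun t => ((starRingEnd ℂ) (f (circleMap 0 1 t)) *
    diskDeriv f (circleMap 0 1 t) (circleMap 0 1 t)).re with hu
  have hu_eq : ∀ t, u t = (2 * Real.pi)⁻¹ * ∫ s in (0 : ℝ)..2 * Real.pi, argKernel ψ s t := by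
    intro t
    simp only [hu]
    rw [radialFlux_eq_circleAverage_chordKernel hharm hC1 hs (hsph t), Real.circleAverage,
      smul_eq_mul]
    simp only [hker]
  have hpi : (0 : ℝ) < 2 * Real.pi := by positivity
  have hu_nonneg : ∀ t, 0 ≤ u t := fun t => by
    rw [hu_eq]
    exact mul_nonneg (inv_nonneg.2 hpi.le)
      (intervalIntegral.integral_nonneg hpi.le fun s _ => argKernel_nonneg s t)
  have hfc : Continuous fun t => f (circleMap 0 1 t) := hC1.continuousOn.comp_continuous hcm hmem
  have hu_cont : Continuous u := Complex.continuous_re.comp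
    ((Complex.continuous_conj.comp hfc).mul (hAc.clm_apply hcm))
  have hE : diskEnergy f = ∫ t in (0 : ℝ)..2 * Real.pi, u t := by
    rw [diskEnergy_eq_circleAverage hharm hC1, Real.circleAverage, smul_eq_mul,
      mul_inv_cancel_left₀ hpi.ne']
  have hB : boundaryJacobian f = ∫ t in (0 : ℝ)..2 * Real.pi, ψ' t * u t := by
    refine intervalIntegral.integral_congr fun t _ => ?_
    have h1 : (diskDeriv f (circleMap 0 1 t)).det = σ * ψ' t * u t := by
      rw [det_eq_im_conj_mul_of_norm_eq_one _ (norm_circleMap_one t), hder t, hu]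
      simp
      ring
    rw [h1, abs_mul, abs_mul, hσ, one_mul, abs_of_nonneg (hpos t), abs_of_nonneg (hu_nonneg t)]
  have hdiff : boundaryJacobian f - diskEnergy f = (2 * Real.pi)⁻¹ *
      ∫ t in (0 : ℝ)..2 * Real.pi,
        (ψ' t - 1) * ∫ s in (0 : ℝ)..2 * Real.pi, argKernel ψ s t := by
    have i1 : IntervalIntegrable (fun t => ψ' t * u t) MeasureTheory.volume 0 (2 * Real.pi) :=
      (hψ'.mul hu_cont).intervalIntegrable _ _
    rw [hE, hB, ← intervalIntegral.integral_sub i1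
      (hu_cont.intervalIntegrable _ _), ← intervalIntegral.integral_const_mul]
    refine intervalIntegral.integral_congr fun t _ => ?_
    rw [hu_eq]; ring
  obtain ⟨k1, k2⟩ := integral_mul_integral_argKernel_nonneg hψ hψ' hpos hper hM
  have hle : diskEnergy f ≤ boundaryJacobian f := by
    have := mul_nonneg (inv_nonneg.2 hpi.le) k1
    linarith
  refine ⟨hle, two_mul_diskJacobian_le hC1, by rw [diskJacobian_eq_pi hC1 hhomeo.1],
    fun hlt hiso => hlt.ne ?_, fun hn => lt_of_le_of_ne hle fun heq => hn ?_⟩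
  · rw [hE, hB]
    refine intervalIntegral.integral_congr fun t _ => ?_
    have h1 := norm_deriv_boundary_eq_one_of_isometry hiso (hγ t)
    rw [hder t, norm_mul, norm_mul, Complex.norm_I, Complex.norm_real, Real.norm_eq_abs, abs_mul,
      hσ, abs_of_nonneg (hpos t), show ‖f (circleMap 0 1 t)‖ = 1 by simpa using hs (hsph t)] at h1
    have h2 : ψ' t = 1 := by linarith
    rw [h2, one_mul]
  · rw [heq, sub_self] at hdiff
    obtain ⟨c, hc⟩ := k2 ((mul_eq_zero.1 hdiff.symm).resolve_left (inv_ne_zero hpi.ne'))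
    exact isometry_of_boundary_rotation hharm hC1.continuousOn hc hform
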